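/- For $t\in\mathbb{R}$ let $\mathcal{D}_t$ be the Hilbert space of holomorphic functions $f(z)=\sum_{n=1}^\infty a_nz^n$ on the open unit disc $\mathbb{D}$ with $\|f\|_t^2=\sum_{n=1}^\infty|a_n|^2(n+1)^t<\infty$; in particular $\mathcal{D}_0=H^2_0(\mathbb{D})$, the space of functions in the Hardy space $H^2(\mathbb{D})$ vanishing at $0$. Let $S_t:\mathcal{D}_t\to H^2_0(\mathbb{D})$ be the map $\sum_{n\ge1}a_nz^n\mapsto\sum_{n\ge1}a_nn^{t/2}z^n$. Let $\mathbb{T}^\infty=\mathbb{T}\times\mathbb{T}\times\cdots$ be the infinite torus with its normalized Haar measure $\rho$, let $H^2(\mathbb{T}^\infty)$ be the closed linear span in $L^2(\mathbb{T}^\infty,\rho)$ of the monomials $\zeta^\alpha=\prod_j\zeta_j^{\alpha_j}$ over all finitely supported sequences $\alpha$ of non-negative integers, and let $H^\infty(\mathbb{T}^\infty)$ be the algebra of (essentially) bounded functions in $H^2(\mathbb{T}^\infty)$ with the pointwise product. For an integer $n\ge1$ with prime factorization $n=p_1^{\alpha_1}\cdots p_m^{\alpha_m}$, where $p_j$ is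 the $j$-th prime, write $\alpha(n)=(\alpha_1,\dots,\alpha_m,0,0,\dots)$. Let $\mathcal{B}:H^2_0(\mathbb{D})\to H^2(\mathbb{T}^\infty)$ be the Bohr transform $\sum_{n\ge1}a_nz^n\mapsto\sum_{n\ge1}a_n\zeta^{\alpha(n)}$, and put $\mathcal{B}_t=\mathcal{B}S_t$. A sequence $\{x_k\}_{k\ge1}$ in a Hilbert space $H$ is an unconditional basis for $H$ if for every $x\in H$ there is a unique sequence of scalars $\{c_k\}_{k\ge1}$ such that $x=\sum_{k=1}^\infty c_kx_k$, and if moreover, for every $x\in H$ and every permutation $\sigma$ of $\{1,2,\dots\}$, the series $\sum_{k=1}^\infty c_{\sigma(k)}x_{\sigma(k)}$ converges to $x$. **Theorem.** Suppose $t\in\mathbb{R}$ and $f\in\mathcal{D}_t$. Then the sequence $\{f(z^k)\}_{k\ge1}$ is an unconditional basis for $\mathcal{D}_t$ if and only if $\mathcal{B}_tf$ is invertible in $H^\infty(\mathbb{T}^\infty)$, that is, $\mathcal{B}_tf\in H^\infty(\mathbb{T}^\infty)$ and there is $G\in H^\infty(\mathbb{T}^\infty)$ with $G\cdot\mathcal{B}_tf=1$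 $\rho$-almost everywhere. -/

import Mathlib

open Filter Topology MeasureTheory
open scoped Complex.UnitDisc ENNReal

noncomputable section

namespace PowerDilation

/-! ### Dirichlet-type spaces on the unit disc -/

/-- `f(z) = ∑_{n ≥ 1} a_n z^n` on the whole open unit disc. -/
def HasTaylor (f : 𝔻 → ℂ) (a : ℕ+ → ℂ) : Prop :=
  ∀ z : 𝔻, HasSum (fun n : ℕ+ => a n * (z : ℂ) ^ (n : ℕ)) (f z)

/-- `∑_{n ≥ 1} |a_n|^2 (n+1)^t < ∞`. -/
def WeightedSummable (t : ℝ) (a : ℕ+ → ℂ) : Prop :=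
  Summable fun n : ℕ+ => ‖a n‖ ^ 2 * ((n : ℝ) + 1) ^ t

theorem HasTaylor.add {f g : 𝔻 → ℂ} {a b : ℕ+ → ℂ} (hf : HasTaylor f a) (hg : HasTaylor g b) :
    HasTaylor (f + g) (a + b) := fun z => by
  simpa [add_mul] using (hf z).add (hg z)

theorem HasTaylor.smul {f : 𝔻 → ℂ} {a : ℕ+ → ℂ} (c : ℂ) (hf : HasTaylor f a) :
    HasTaylor (c • f) (c • a) := fun z => by
  simpa [mul_assoc] using (hf z).mul_left c

theorem HasTaylor.eq_zero {a : ℕ+ → ℂ} (h : HasTaylor 0 a) : a = 0 := by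
  set b : ℕ → ℂ := Function.extend (fun n : ℕ+ => (n : ℕ)) a 0 with hb
  have hinj : Function.Injective (fun n : ℕ+ => (n : ℕ)) := PNat.coe_injective
  have hbn : ∀ n : ℕ+, b n = a n := fun n => hinj.extend_apply a 0 n
  have key : HasFPowerSeriesAt (0 : ℂ → ℂ) (FormalMultilinearSeries.ofScalars ℂ b) 0 := by
    rw [hasFPowerSeriesAt_iff]
    filter_upwards [Metric.ball_mem_nhds (0 : ℂ) one_pos] with z hz
    have hz1 : ‖z‖ < 1 := by simpa using hz
    have h1 := h (Complex.UnitDisc.mk z hz1)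
    have h2 : HasSum (fun n : ℕ => z ^ n * b n) 0 := by
      rw [← hinj.hasSum_iff]
      · convert h1 using 1
        · funext n
          simp [hbn, mul_comm]
        · rfl
      · intro n hn
        have : b n = 0 := by
          rw [hb, Function.extend_apply' _ _ _ (fun ⟨m, hm⟩ => hn ⟨m, hm⟩)]; rfl
        simp [this]
    simpa using h2
  have h0 := key.eq_zero
  funext n
  have h1 : FormalMultilinearSeries.coeff (FormalMultilinearSeries.ofScalars ℂ b) (n : ℕ) = 0 := by
    rw [h0]; rfl
  simpa [hbn] using h1

theorem HasTaylor.unique {f : 𝔻 → ℂ} {a b : ℕ+ → ℂ} (ha : HasTaylor f a) (hb : HasTaylor f b) :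
    a = b := by
  have h := ha.add (hb.smul (-1))
  have h' : HasTaylor 0 (a + (-1 : ℂ) • b) := by
    convert h using 1
    simp
  have := h'.eq_zero
  rw [neg_one_smul, ← sub_eq_add_neg, sub_eq_zero] at this
  exact this

theorem weightedSummable_iff_memℓp (t : ℝ) (a : ℕ+ → ℂ) :
    WeightedSummable t a ↔
      Memℓp (fun n : ℕ+ => a n * ((((n : ℝ) + 1) ^ (t / 2) : ℝ) : ℂ)) 2 := by
  rw [memℓp_gen_iff (by norm_num)]
  refine summable_congr fun n => ?_
  have hn : (0 : ℝ) ≤ (n : ℝ) + 1 := by positivity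
  simp only [norm_mul, Complex.norm_real, Real.norm_eq_abs, ENNReal.toReal_ofNat, Real.rpow_ofNat,
    mul_pow, sq_abs]
  rw [← Real.rpow_natCast, ← Real.rpow_natCast, ← Real.rpow_mul hn]
  norm_num

theorem WeightedSummable.add {t : ℝ} {a b : ℕ+ → ℂ} (ha : WeightedSummable t a)
    (hb : WeightedSummable t b) : WeightedSummable t (a + b) := by
  rw [weightedSummable_iff_memℓp] at *
  convert ha.add hb using 1
  funext n; simp [add_mul]

theorem WeightedSummable.smul {t : ℝ} {a : ℕ+ → ℂ} (c : ℂ) (ha : WeightedSummable t a) :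
    WeightedSummable t (c • a) := by
  rw [weightedSummable_iff_memℓp] at *
  convert ha.const_smul c using 1
  funext n; simp [mul_assoc]

/-- The functions `f(z) = ∑_{n ≥ 1} a_n z^n` holomorphic on the open unit disc with
`∑ |a_n|^2 (n+1)^t < ∞`, as a linear space of functions on the disc. -/
def dirichletSubmodule (t : ℝ) : Submodule ℂ (𝔻 → ℂ) where
  carrier := {f | ∃ a : ℕ+ → ℂ, HasTaylor f a ∧ WeightedSummable t a}
  zero_mem' := ⟨0, fun z => by simp,
    by simp [WeightedSummable]⟩
  add_mem' := by
    rintro f g ⟨a, ha, ha'⟩ ⟨b, hb, hb'⟩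
    exact ⟨a + b, ha.add hb, ha'.add hb'⟩
  smul_mem' := by
    rintro c f ⟨a, ha, ha'⟩
    exact ⟨c • a, ha.smul c, ha'.smul c⟩

/-- The Dirichlet-type space `𝒟_t`. It is a type of its own, so that its topology is the norm
topology introduced below and not the topology of pointwise convergence. -/
def DirichletSpace (t : ℝ) : Type := dirichletSubmodule t

namespace DirichletSpace

variable {t : ℝ}

instance : AddCommGroup (DirichletSpace t) := inferInstanceAs (AddCommGroup (dirichletSubmodule t))
instance : Module ℂ (DirichletSpace t) := inferInstanceAs (Module ℂ (dirichletSubmodule t))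

/-- The underlying function on the disc. -/
def toFun (f : DirichletSpace t) : 𝔻 → ℂ := f.1

/-- The Taylor coefficients `a_n`, `n ≥ 1`, of `f ∈ 𝒟_t` (unique by `HasTaylor.unique`). -/
def coeff (f : DirichletSpace t) : ℕ+ → ℂ := f.2.choose

theorem hasTaylor (f : DirichletSpace t) : HasTaylor f.toFun f.coeff := f.2.choose_spec.1

theorem weightedSummable (f : DirichletSpace t) : WeightedSummable t f.coeff :=
  f.2.choose_spec.2

theorem coeff_eq {f : DirichletSpace t} {a : ℕ+ → ℂ} (h : HasTaylor f.toFun a) : f.coeff = a :=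
  f.hasTaylor.unique h

theorem coeff_add (f g : DirichletSpace t) : (f + g).coeff = f.coeff + g.coeff :=
  coeff_eq (f.hasTaylor.add g.hasTaylor)

theorem coeff_smul (c : ℂ) (f : DirichletSpace t) : (c • f).coeff = c • f.coeff :=
  coeff_eq (f.hasTaylor.smul c)

theorem coeff_injective : Function.Injective (coeff : DirichletSpace t → ℕ+ → ℂ) := by
  intro f g h
  apply Subtype.ext
  funext z
  have h1 := f.hasTaylor z
  rw [h] at h1
  exact h1.unique (g.hasTaylor z)

/-- The weighted coefficient sequence `(a_n (n+1)^{t/2})_n`, an element of `ℓ²`. -/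
def weightedCoeff : DirichletSpace t →ₗ[ℂ] lp (fun _ : ℕ+ => ℂ) 2 where
  toFun f := ⟨fun n => f.coeff n * ((((n : ℝ) + 1) ^ (t / 2) : ℝ) : ℂ),
    (weightedSummable_iff_memℓp t _).1 f.weightedSummable⟩
  map_add' f g := by
    apply Subtype.ext
    funext n
    simp only [coeff_add, Pi.add_apply, add_mul]
    rfl
  map_smul' c f := by
    apply Subtype.ext
    funext n
    simp [coeff_smul, mul_assoc]

theorem weightedCoeff_injective :
    Function.Injective (weightedCoeff : DirichletSpace t →ₗ[ℂ] lp (fun _ : ℕ+ => ℂ) 2) := by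
  intro f g h
  apply coeff_injective
  funext n
  have h1 := congrArg (fun x : lp (fun _ : ℕ+ => ℂ) 2 => (x : ∀ _ : ℕ+, ℂ) n) h
  have hn : (0 : ℝ) < ((n : ℝ) + 1) ^ (t / 2) := by positivity
  exact mul_right_cancel₀ (Complex.ofReal_ne_zero.2 hn.ne') h1

/-- The norm of `𝒟_t`; see `norm_sq` for the usual formula. -/
instance : NormedAddCommGroup (DirichletSpace t) :=
  NormedAddCommGroup.induced (DirichletSpace t) (lp (fun _ : ℕ+ => ℂ) 2) weightedCoeff
    weightedCoeff_injective

/-- The inner product `⟪f, g⟫ = ∑ conj(a_n) b_n (n+1)^t`. -/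
instance : InnerProductSpace ℂ (DirichletSpace t) where
  norm_smul_le c f := by
    change ‖weightedCoeff (c • f)‖ ≤ ‖c‖ * ‖weightedCoeff f‖
    rw [map_smul, norm_smul]
  inner f g := inner ℂ (weightedCoeff f) (weightedCoeff g)
  norm_sq_eq_re_inner f := norm_sq_eq_re_inner (𝕜 := ℂ) (weightedCoeff f)
  conj_inner_symm f g := inner_conj_symm (weightedCoeff f) (weightedCoeff g)
  add_left f g h := by rw [map_add, inner_add_left]
  smul_left f g c := by rw [map_smul, inner_smul_left]

theorem norm_sq (f : DirichletSpace t) :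
    ‖f‖ ^ 2 = ∑' n : ℕ+, ‖f.coeff n‖ ^ 2 * ((n : ℝ) + 1) ^ t := by
  have h : ‖f‖ = ‖weightedCoeff f‖ := rfl
  have h2 := lp.norm_rpow_eq_tsum (p := 2) (by norm_num) (weightedCoeff f)
  rw [h]
  simp only [ENNReal.toReal_ofNat, Real.rpow_ofNat] at h2
  rw [h2]
  refine tsum_congr fun n => ?_
  have hn : (0 : ℝ) ≤ (n : ℝ) + 1 := by positivity
  change ‖f.coeff n * ((((n : ℝ) + 1) ^ (t / 2) : ℝ) : ℂ)‖ ^ 2 = _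
  simp only [norm_mul, Complex.norm_real, Real.norm_eq_abs, mul_pow, sq_abs]
  rw [← Real.rpow_natCast (((n : ℝ) + 1) ^ (t / 2)), ← Real.rpow_mul hn]
  norm_num

end DirichletSpace

theorem rpow_le_of_comparable {c x y t : ℝ} (hc : 1 ≤ c) (hx : 0 < x) (hy : 0 < y)
    (hxy : x ≤ c * y) (hyx : y ≤ c * x) : x ^ t ≤ c ^ |t| * y ^ t := by
  have hc0 : 0 < c := by linarith
  rcases le_total 0 t with ht | ht
  · rw [abs_of_nonneg ht, ← Real.mul_rpow hc0.le hy.le]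
    exact Real.rpow_le_rpow hx.le hxy ht
  · rw [abs_of_nonpos ht]
    have h1 : (c * x) ^ t ≤ y ^ t := Real.rpow_le_rpow_of_nonpos hy hyx ht
    rw [Real.mul_rpow hc0.le hx.le] at h1
    calc x ^ t = c ^ (-t) * (c ^ t * x ^ t) := by
          rw [← mul_assoc, ← Real.rpow_add hc0]; simp
      _ ≤ c ^ (-t) * y ^ t := by gcongr

theorem WeightedSummable.hasTaylor {t : ℝ} {a : ℕ+ → ℂ} (h : WeightedSummable t a) :
    HasTaylor (fun z => ∑' n : ℕ+, a n * (z : ℂ) ^ (n : ℕ)) a := by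
  intro z
  apply Summable.hasSum
  set r : ℝ := ‖(z : ℂ)‖ with hr
  have hr1 : r < 1 := z.norm_lt_one
  have hr0 : 0 ≤ r := norm_nonneg _
  obtain ⟨m, hm⟩ := exists_nat_ge (-t)
  have hr2 : ‖r ^ 2‖ < 1 := by
    rw [Real.norm_of_nonneg (by positivity)]
    exact pow_lt_one₀ hr0 hr1 two_ne_zero
  have hs0 : Summable fun n : ℕ => (2 : ℝ) ^ m * ((n : ℝ) ^ m * (r ^ 2) ^ n) :=
    (summable_pow_mul_geometric_of_norm_lt_one m hr2).mul_left _
  have hs1 : Summable fun n : ℕ+ => (2 : ℝ) ^ m * ((n : ℝ) ^ m * (r ^ 2) ^ (n : ℕ)) :=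
    hs0.comp_injective PNat.coe_injective
  refine Summable.of_norm_bounded (Summable.add h hs1) fun n => ?_
  have hn1 : (1 : ℝ) ≤ (n : ℝ) := by exact_mod_cast n.pos
  set w : ℝ := ((n : ℝ) + 1) ^ (t / 2) with hw
  have hwpos : 0 < w := by positivity
  have hw2 : ((n : ℝ) + 1) ^ t = w ^ 2 := by
    rw [hw, ← Real.rpow_natCast, ← Real.rpow_mul (by positivity)]; norm_num
  have hwinv : (w⁻¹) ^ 2 ≤ (2 : ℝ) ^ m * (n : ℝ) ^ m := by
    rw [inv_pow, ← hw2, ← Real.rpow_neg (by positivity), ← mul_pow]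
    calc ((n : ℝ) + 1) ^ (-t) ≤ ((n : ℝ) + 1) ^ (m : ℝ) :=
          Real.rpow_le_rpow_of_exponent_le (by linarith) hm
      _ = ((n : ℝ) + 1) ^ m := Real.rpow_natCast _ _
      _ ≤ (2 * (n : ℝ)) ^ m := by gcongr; linarith
  rw [norm_mul, norm_pow, ← hr, hw2]
  have h3 : ‖a n‖ * r ^ (n : ℕ) = (‖a n‖ * w) * (w⁻¹ * r ^ (n : ℕ)) := by
    field_simp
  have h4 : (w⁻¹ * r ^ (n : ℕ)) ^ 2 ≤ (2 : ℝ) ^ m * ((n : ℝ) ^ m * (r ^ 2) ^ (n : ℕ)) := by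
    rw [mul_pow, ← mul_assoc, ← pow_mul, ← pow_mul, mul_comm (n : ℕ) 2]
    gcongr
  rw [h3, ← mul_pow]
  generalize ‖a n‖ * w = x at *
  generalize w⁻¹ * r ^ (n : ℕ) = y at *
  have h5 : x * y ≤ x ^ 2 + y ^ 2 := by
    nlinarith [sq_nonneg (x - y), sq_nonneg x, sq_nonneg y]
  exact h5.trans (by linarith)

/-- The element `∑_{n ≥ 1} a_n z^n` of `𝒟_t` with prescribed Taylor coefficients. -/
def DirichletSpace.ofCoeff {t : ℝ} (a : ℕ+ → ℂ) (h : WeightedSummable t a) : DirichletSpace t :=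
  ⟨fun z => ∑' n : ℕ+, a n * (z : ℂ) ^ (n : ℕ), a, h.hasTaylor, h⟩

theorem DirichletSpace.coeff_ofCoeff {t : ℝ} (a : ℕ+ → ℂ) (h : WeightedSummable t a) :
    (DirichletSpace.ofCoeff a h).coeff = a :=
  DirichletSpace.coeff_eq h.hasTaylor

/-- The Hardy space `H²₀(𝔻) = {f ∈ H²(𝔻) : f(0) = 0}`, that is `𝒟_0`. -/
abbrev HardyDisc : Type := DirichletSpace 0

/-! ### Power dilations -/

theorem dilate_mem {t : ℝ} (f : DirichletSpace t) (k : ℕ+) :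
    (fun z : 𝔻 => f.toFun (z ^ k)) ∈ dirichletSubmodule t := by
  have hinj : Function.Injective (fun n : ℕ+ => k * n) := mul_right_injective k
  set b : ℕ+ → ℂ := Function.extend (fun n : ℕ+ => k * n) f.coeff 0 with hb
  have hbn : ∀ n : ℕ+, b (k * n) = f.coeff n := fun n => hinj.extend_apply f.coeff 0 n
  have hb0 : ∀ n, n ∉ Set.range (fun n : ℕ+ => k * n) → b n = 0 := by
    intro n hn
    rw [hb, Function.extend_apply' _ _ _ (fun ⟨m, hm⟩ => hn ⟨m, hm⟩)]; rfl
  refine ⟨b, fun z => ?_, ?_⟩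
  · rw [← hinj.hasSum_iff (fun n hn => by simp [hb0 n hn])]
    convert f.hasTaylor (z ^ k) using 1
    funext n
    simp [hbn, pow_mul]
  · unfold WeightedSummable
    rw [← hinj.summable_iff (fun n hn => by simp [hb0 n hn])]
    refine Summable.of_nonneg_of_le (fun n => ?_) (fun n => ?_)
      (f.weightedSummable.mul_left ((k : ℝ) ^ |t|))
    · simp only [Function.comp]; positivity
    · have hk1 : (1 : ℝ) ≤ (k : ℝ) := by exact_mod_cast k.pos
      have hn0 : (0 : ℝ) < (n : ℝ) := by exact_mod_cast n.pos
      have := rpow_le_of_comparable (c := k) (x := (k : ℝ) * n + 1) (y := (n : ℝ) + 1) (t := t)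
        hk1 (by positivity) (by positivity) (by nlinarith)
        (by nlinarith [mul_nonneg (mul_nonneg (sub_nonneg.2 hk1) hn0.le) (add_nonneg zero_le_one
          (zero_le_one.trans hk1))])
      simp only [Function.comp, hbn, PNat.mul_coe, Nat.cast_mul]
      calc ‖f.coeff n‖ ^ 2 * ((k : ℝ) * n + 1) ^ t
          ≤ ‖f.coeff n‖ ^ 2 * ((k : ℝ) ^ |t| * ((n : ℝ) + 1) ^ t) := by gcongr
        _ = _ := by ring

/-- The power dilation `z ↦ f(z^k)` of `f ∈ 𝒟_t`, `k ≥ 1`. -/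
def dilate {t : ℝ} (f : DirichletSpace t) (k : ℕ+) : DirichletSpace t :=
  ⟨fun z : 𝔻 => f.toFun (z ^ k), dilate_mem f k⟩

/-! ### Schauder bases and unconditional bases -/

section Bases

variable {H : Type*} [NormedAddCommGroup H] [NormedSpace ℂ H]

/-- The series `∑ c_k x_k` converges to `v` (limit of the partial sums in the given order). -/
def SeriesConvergesTo (c : ℕ → ℂ) (x : ℕ → H) (v : H) : Prop :=
  Tendsto (fun N => ∑ k ∈ Finset.range N, c k • x k) atTop (𝓝 v)

/-- Every vector has a unique expansion `v = ∑ c_k x_k`. -/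
def IsSchauderBasis (x : ℕ → H) : Prop :=
  ∀ v : H, ∃! c : ℕ → ℂ, SeriesConvergesTo c x v

/-- A Schauder basis all of whose expansions converge to the same vector after every
permutation of the terms. -/
def IsUnconditionalBasis (x : ℕ → H) : Prop :=
  IsSchauderBasis x ∧ ∀ (v : H) (c : ℕ → ℂ), SeriesConvergesTo c x v →
    ∀ σ : Equiv.Perm ℕ, SeriesConvergesTo (c ∘ σ) (x ∘ σ) v

end Bases

/-! ### The Hardy spaces on the infinite torus -/

instance : MeasurableSpace Circle := borel Circle
instance : BorelSpace Circle := ⟨rfl⟩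

/-- The infinite torus `𝕋 × 𝕋 × ⋯` with the product topology. -/
abbrev InfTorus : Type := ℕ → Circle

/-- The normalized Haar measure `ρ` of the infinite torus. -/
def rho : Measure InfTorus := Measure.haarMeasure (⊤ : TopologicalSpace.PositiveCompacts InfTorus)

instance : IsProbabilityMeasure rho :=
  ⟨Measure.haarMeasure_self (K₀ := (⊤ : TopologicalSpace.PositiveCompacts InfTorus))⟩

instance : rho.IsMulLeftInvariant := by unfold rho; infer_instance

/-- The monomial `ζ^α = ∏_j ζ_j^{α_j}` for a finitely supported multi-index `α`. -/
def monomial (α : ℕ →₀ ℕ) : C(InfTorus, ℂ) where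
  toFun ζ := ∏ j ∈ α.support, (ζ j : ℂ) ^ α j
  continuous_toFun := by fun_prop

/-- The monomial `ζ^α` as an element of `L²(𝕋^∞, ρ)`. -/
def monomialL2 (α : ℕ →₀ ℕ) : Lp ℂ 2 rho := ContinuousMap.toLp 2 rho ℂ (monomial α)

/-- `H²(𝕋^∞)`: the closed linear span of the monomials in `L²(𝕋^∞, ρ)`. -/
def hardyH2 : Submodule ℂ (Lp ℂ 2 rho) :=
  (Submodule.span ℂ (Set.range monomialL2)).topologicalClosure

instance : CompleteSpace hardyH2 :=
  (Submodule.isClosed_topologicalClosure _).completeSpace_coe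

/-- The monomial `ζ^α` as an element of `H²(𝕋^∞)`. -/
def monomialH2 (α : ℕ →₀ ℕ) : hardyH2 :=
  ⟨monomialL2 α, Submodule.le_topologicalClosure _ (Submodule.subset_span ⟨α, rfl⟩)⟩

/-- `H^∞(𝕋^∞)`: the (essentially) bounded functions in `H²(𝕋^∞)`. -/
def hardyHInf : Set hardyH2 := {F | eLpNorm (F : Lp ℂ 2 rho) ∞ rho < ∞}

/-- `F` is an invertible element of the algebra `H^∞(𝕋^∞)` with the pointwise product. -/
def IsInvertibleInHInf (F : hardyH2) : Prop :=
  F ∈ hardyHInf ∧ ∃ G ∈ hardyHInf,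
    ∀ᵐ ζ ∂rho, (F : Lp ℂ 2 rho) ζ * (G : Lp ℂ 2 rho) ζ = 1

/-! ### The Bohr transform -/

/-- The multi-index `α(n)` of exponents in the prime factorization of `n`: the `j`-th entry
is the exponent of the `j`-th prime (counted from `0`) in `n`. -/
def primeExponents (n : ℕ+) : ℕ →₀ ℕ :=
  (n : ℕ).factorization.comapDomain (Nat.nth Nat.Prime)
    (Nat.nth_injective Nat.infinite_setOfPred_prime).injOn

/-- The Bohr transform `∑ a_n z^n ↦ ∑ a_n ζ^{α(n)}`; the series converges in `H²(𝕋^∞)`, see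
`hasSum_bohr`. -/
def bohr (f : HardyDisc) : hardyH2 := ∑' n : ℕ+, f.coeff n • monomialH2 (primeExponents n)

theorem weightedSummable_weight {t : ℝ} (f : DirichletSpace t) :
    WeightedSummable 0 fun n : ℕ+ => f.coeff n * (((n : ℝ) ^ (t / 2) : ℝ) : ℂ) := by
  refine Summable.of_nonneg_of_le (fun n => by positivity) (fun n => ?_)
    (f.weightedSummable.mul_left ((2 : ℝ) ^ |t|))
  have hn1 : (1 : ℝ) ≤ (n : ℝ) := by exact_mod_cast n.pos
  have h := rpow_le_of_comparable (c := 2) (x := (n : ℝ)) (y := (n : ℝ) + 1) (t := t)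
    (by norm_num) (by positivity) (by positivity) (by linarith) (by linarith)
  have h2 : ((n : ℝ) ^ (t / 2)) ^ 2 = (n : ℝ) ^ t := by
    rw [← Real.rpow_natCast, ← Real.rpow_mul (by positivity)]; norm_num
  rw [norm_mul, mul_pow, Complex.norm_real, Real.norm_eq_abs, sq_abs, h2, Real.rpow_zero, mul_one]
  calc ‖f.coeff n‖ ^ 2 * (n : ℝ) ^ t ≤ ‖f.coeff n‖ ^ 2 * (2 ^ |t| * ((n : ℝ) + 1) ^ t) := by gcongr
    _ = _ := by ring

/-- The operator `S_t : 𝒟_t → H²₀(𝔻)`, `∑ a_n z^n ↦ ∑ a_n n^{t/2} z^n`. -/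
def weightMap (t : ℝ) (f : DirichletSpace t) : HardyDisc :=
  DirichletSpace.ofCoeff (fun n : ℕ+ => f.coeff n * (((n : ℝ) ^ (t / 2) : ℝ) : ℂ))
    (weightedSummable_weight f)

/-- `ℬ_t = ℬ S_t`. -/
def bohrT (t : ℝ) (f : DirichletSpace t) : hardyH2 := bohr (weightMap t f)

/-! ### Convergence of the series defining the Bohr transform -/

theorem primeExponents_injective : Function.Injective primeExponents := by
  intro m n h
  apply PNat.coe_injective
  apply Nat.eq_of_factorization_eq m.ne_zero n.ne_zero
  intro p
  by_cases hp : p.Prime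
  · obtain ⟨j, rfl⟩ : ∃ j, Nat.nth Nat.Prime j = p := ⟨_, Nat.nth_count hp⟩
    exact DFunLike.congr_fun h j
  · simp [Nat.factorization_eq_zero_of_not_prime _ hp]

theorem monomial_mul_single (α : ℕ →₀ ℕ) (j : ℕ) (u : Circle) (ζ : InfTorus) :
    monomial α (Pi.mulSingle j u * ζ) = (u : ℂ) ^ α j * monomial α ζ := by
  have h : ∀ η : InfTorus, monomial α η = ∏ i ∈ insert j α.support, (η i : ℂ) ^ α i := by
    intro η
    refine Finset.prod_subset (Finset.subset_insert _ _) fun i _ hi => ?_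
    simp [Finsupp.notMem_support_iff.1 hi]
  rw [h, h]
  simp only [Pi.mul_apply, Circle.coe_mul, mul_pow, Finset.prod_mul_distrib]
  congr 1
  rw [Finset.prod_eq_single j]
  · simp
  · intro i _ hij
    simp [Pi.mulSingle_eq_of_ne hij]
  · simp

theorem inner_monomialL2_of_ne {α β : ℕ →₀ ℕ} (h : α ≠ β) :
    inner ℂ (monomialL2 α) (monomialL2 β) = 0 := by
  obtain ⟨j, hj⟩ := DFunLike.ne_iff.1 h
  unfold monomialL2
  rw [ContinuousMap.inner_toLp]
  set I : ℂ := ∫ ζ, monomial β ζ * (starRingEnd ℂ) (monomial α ζ) ∂rho with hI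
  obtain ⟨u, hu⟩ : ∃ u : Circle, (u : ℂ) ^ β j * (starRingEnd ℂ) ((u : ℂ) ^ α j) ≠ 1 := by
    have hd : ((β j : ℝ) - α j) ≠ 0 := sub_ne_zero.2 fun hc => hj (by exact_mod_cast hc.symm)
    set x : ℝ := Real.pi / ((β j : ℝ) - α j) with hx
    refine ⟨Circle.exp x, fun hc => Circle.exp_pi_ne_one ?_⟩
    rw [← Circle.coe_pow, ← Circle.coe_pow, ← Circle.coe_inv_eq_conj, ← Circle.coe_mul,
      Circle.coe_eq_one, ← Circle.exp_natCast_mul, ← Circle.exp_natCast_mul, ← Circle.exp_neg,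
      ← Circle.exp_add] at hc
    rw [← hc]
    congr 1
    rw [hx]
    field_simp
    ring
  have h1 : I = ((u : ℂ) ^ β j * (starRingEnd ℂ) ((u : ℂ) ^ α j)) * I := by
    conv_lhs => rw [hI, ← integral_mul_left_eq_self _ (Pi.mulSingle j u)]
    rw [hI, ← integral_const_mul]
    congr 1
    funext ζ
    rw [monomial_mul_single, monomial_mul_single, map_mul]
    ring
  have h2 : (((u : ℂ) ^ β j * (starRingEnd ℂ) ((u : ℂ) ^ α j)) - 1) * I = 0 := by
    rw [sub_mul, ← h1]; ring
  exact (mul_eq_zero.1 h2).resolve_left (sub_ne_zero.2 hu)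

theorem norm_monomialL2 (α : ℕ →₀ ℕ) : ‖monomialL2 α‖ = 1 := by
  have h : inner ℂ (monomialL2 α) (monomialL2 α) = 1 := by
    unfold monomialL2
    rw [ContinuousMap.inner_toLp]
    have h1 : ∀ ζ, monomial α ζ * (starRingEnd ℂ) (monomial α ζ) = 1 := by
      intro ζ
      rw [Complex.mul_conj']
      have h2 : ‖monomial α ζ‖ = 1 := by simp [monomial, norm_prod, Circle.norm_coe]
      simp [h2]
    simp [h1]
  rw [inner_self_eq_norm_sq_to_K] at h
  have h2 : ‖monomialL2 α‖ ^ 2 = 1 := by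
    apply Complex.ofReal_injective
    push_cast
    exact h
  nlinarith [norm_nonneg (monomialL2 α)]

theorem orthonormal_monomialH2 : Orthonormal ℂ monomialH2 :=
  ⟨fun α => norm_monomialL2 α, fun _ _ h => inner_monomialL2_of_ne h⟩

theorem hasSum_bohr (f : HardyDisc) :
    HasSum (fun n : ℕ+ => f.coeff n • monomialH2 (primeExponents n)) (bohr f) := by
  apply Summable.hasSum
  have ho := orthonormal_monomialH2.comp _ primeExponents_injective
  have h := ho.orthogonalFamily.summable_iff_norm_sq_summable (f := f.coeff)
  have h1 : Summable fun n : ℕ+ => ‖f.coeff n‖ ^ 2 := by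
    simpa [WeightedSummable] using f.weightedSummable
  simpa using h.2 h1

end PowerDilation

end

/-!
The weighted Bohr transform `ℬ_t` is an isomorphism from `𝒟_t` onto `H²(𝕋^∞)` (`bohrTEquiv`),
because the weights `n^t` and `(n+1)^t` are comparable and the monomials `ζ^{α(n)}` form an
orthonormal basis. Since `n^{t/2}` and `n ↦ ζ^{α(n)}` are multiplicative, it carries `f(z^k)` to
`k^{t/2} ζ^{α(k)} F` with `F = ℬ_t f` (`bohrT_dilate`). Isomorphisms and rescalings preserve
unconditional bases, so the question is when the multiples `ζ^{α(k)} F` are an unconditional basis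
of `H²(𝕋^∞)`.

If `F` is invertible in `H^∞`, multiplication by `F` is an automorphism of `H²(𝕋^∞)` that maps the
orthonormal basis of monomials to this sequence (`isUnconditionalBasis_shift_of_invertible`).

Conversely, suppose that the sequence is an unconditional basis. Its members all have norm `‖F‖`,
so by the Köthe–Toeplitz theorem (`IsUnconditionalBasis.exists_riesz_bounds`) it is a Riesz basis:
`‖p F‖` is comparable to `‖p‖` for analytic polynomials `p`. The proof of that theorem
here rests on three facts.
* The coefficients of an expansion depend continuously on its sum. The Fourier coefficient at `α(n)`
  of `ζ^{α(k)} F` vanishes for `k > n` and is the non-zero constant term of `F` for `k = n`, so the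
  coefficients can be solved for recursively (`exists_coord_of_triangular`).
* If every rearrangement of a series converges, its finite subsums are bounded
  (`exists_norm_sum_le_of_forall_perm_tendsto`), so the Banach–Steinhaus theorem bounds all partial
  expansions uniformly.
* Signs can be chosen greedily so that a signed sum has norm at most, or at least, that of an
  orthogonal sum.

Dividing analytic polynomials by monomials gives the trigonometric polynomials, which are dense in
the continuous functions; hence `‖g F‖ ≤ C ‖g‖` for all continuous `g`, and `|F| ≤ C` almost
everywhere (`ae_norm_le_of_norm_mulC_le`). Multiplication by `F` is now a bounded operator on
`H²(𝕋^∞)`, bounded below and with dense range, so `F G = 1` for some `G` in `H²(𝕋^∞)`. The lower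
bound for `F` is an upper bound for multiplication by `G`, and `G` is bounded for the same reason.
-/

noncomputable section

namespace PowerDilation

/-! ### Rearrangements along an exhaustion -/

/-- An increasing exhaustion of `ℕ` by finite sets occurs among the initial segments of a suitable
permutation. -/
theorem exists_perm_map_range_eq {B : ℕ → Finset ℕ} (hB : Monotone B) (hex : ∀ k, ∃ n, k ∈ B n) :
    ∃ σ : Equiv.Perm ℕ, ∀ n, (Finset.range (B n).card).map σ.toEmbedding = B n := by
  -- The rank of `k` is the first stage that contains it; `g` shifts the stages apart, so that
  -- sorting by `key` lists the stages one after the other.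
  set r : ℕ → ℕ := fun k => Nat.find (hex k) with hr
  have hrB : ∀ k n, k ∈ B n ↔ r k ≤ n := fun k n =>
    ⟨fun h => Nat.find_min' (hex k) h, fun h => hB h (Nat.find_spec (hex k))⟩
  set g : ℕ → ℕ := fun n => ∑ i ∈ Finset.range n, ((B i).sup id + 1) with hg
  have hgm : Monotone g := fun a b hab =>
    Finset.sum_le_sum_of_subset (Finset.range_mono hab)
  set key : ℕ → ℕ := fun k => k + g (r k) with hkey
  have hlt : ∀ {j k}, r j < r k → key j < key k := by
    intro j k hjk
    have h1 : j ≤ (B (r j)).sup id := Finset.le_sup (f := id) ((hrB j _).2 le_rfl)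
    have h2 : g (r j + 1) = g (r j) + ((B (r j)).sup id + 1) := Finset.sum_range_succ _ _
    have h3 : g (r j + 1) ≤ g (r k) := hgm hjk
    simp only [hkey]
    omega
  have hinj : Function.Injective key := by
    intro j k hjk
    rcases lt_trichotomy (r j) (r k) with h | h | h
    · exact absurd hjk (hlt h).ne
    · simp only [hkey, h] at hjk
      omega
    · exact absurd hjk (hlt h).ne'
  have : Infinite (Set.range key) := Set.infinite_coe_iff.2 (Set.infinite_range_of_injective hinj)
  set e := Nat.Subtype.orderIsoOfNat (Set.range key) with he
  set σ : Equiv.Perm ℕ := e.toEquiv.trans (Equiv.ofInjective key hinj).symm with hσ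
  have hkσ : ∀ i, key (σ i) = (e i : ℕ) := fun i => by
    have := Equiv.apply_ofInjective_symm hinj (e i)
    simpa [hσ] using this
  have hmono : StrictMono fun i => key (σ i) := fun i j hij => by
    simp only [hkσ]
    exact_mod_cast e.strictMono hij
  refine ⟨σ, fun n => ?_⟩
  set T : Finset ℕ := (B n).image σ.symm with hT
  have hmem : ∀ i, i ∈ T ↔ σ i ∈ B n := by
    intro i
    simp [hT, Equiv.symm_apply_eq]
  have hlow : ∀ i ∈ T, ∀ j ≤ i, j ∈ T := by
    intro i hi j hji
    rw [hmem, hrB] at *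
    by_contra hc
    exact absurd (hlt (lt_of_le_of_lt hi (not_le.1 hc))) (not_lt.2 (hmono.monotone hji))
  have hcard : T.card = (B n).card := Finset.card_image_of_injective _ σ.symm.injective
  have hTr : T = Finset.range (B n).card := by
    refine Finset.eq_of_subset_of_card_le (fun i hi => ?_) (by simp [hcard])
    have : Finset.range (i + 1) ⊆ T := fun j hj =>
      hlow i hi j (Nat.lt_succ_iff.1 (Finset.mem_range.1 hj))
    have := Finset.card_le_card this
    rw [Finset.card_range, hcard] at this
    exact Finset.mem_range.2 this
  rw [← hTr]
  ext k
  simp [hT]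

/-- If all rearrangements of a series converge, then all its finite subsums are bounded. -/
theorem exists_norm_sum_le_of_forall_perm_tendsto {H : Type*} [NormedAddCommGroup H] {y : ℕ → H}
    (h : ∀ σ : Equiv.Perm ℕ, ∃ v, Tendsto (fun N => ∑ k ∈ Finset.range N, y (σ k)) atTop (𝓝 v)) :
    ∃ C, ∀ S : Finset ℕ, ‖∑ k ∈ S, y k‖ ≤ C := by
  by_contra! hc
  have hstep : ∀ (A : Finset ℕ) (C : ℝ), ∃ T, A ⊆ T ∧ C < ‖∑ k ∈ T, y k‖ := by
    intro A C
    obtain ⟨S, hS⟩ := hc (C + ∑ k ∈ A, ‖y k‖)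
    refine ⟨S ∪ A, Finset.subset_union_right, ?_⟩
    have h1 : ∑ k ∈ S ∪ A, y k = ∑ k ∈ S, y k + ∑ k ∈ A \ S, y k := by
      rw [← Finset.union_sdiff_self_eq_union, Finset.sum_union Finset.disjoint_sdiff]
    have h2 : ‖∑ k ∈ A \ S, y k‖ ≤ ∑ k ∈ A, ‖y k‖ := (norm_sum_le _ _).trans
      (Finset.sum_le_sum_of_subset_of_nonneg Finset.sdiff_subset fun _ _ _ => norm_nonneg _)
    have h3 := norm_le_add_norm_add (∑ k ∈ S, y k) (∑ k ∈ A \ S, y k)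
    rw [h1]
    linarith
  choose F hF1 hF2 using hstep
  let B : ℕ → Finset ℕ := fun n => Nat.rec ∅ (fun m A => F (insert m A) m) n
  have hB : ∀ n, B (n + 1) = F (insert n (B n)) n := fun _ => rfl
  obtain ⟨σ, hσ⟩ := exists_perm_map_range_eq (B := B)
    (monotone_nat_of_le_succ fun n =>
      (Finset.subset_insert _ _).trans (hB n ▸ hF1 _ _))
    (fun k => ⟨k + 1, hB k ▸ hF1 _ _ (Finset.mem_insert_self _ _)⟩)
  obtain ⟨v, hv⟩ := h σ
  obtain ⟨C, hC⟩ := hv.norm.bddAbove_range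
  obtain ⟨n, hn⟩ := exists_nat_gt C
  have h1 : ‖∑ k ∈ Finset.range (B (n + 1)).card, y (σ k)‖ ≤ C := hC ⟨_, rfl⟩
  have h2 : ∑ k ∈ Finset.range (B (n + 1)).card, y (σ k) = ∑ k ∈ F (insert n (B n)) n, y k := by
    rw [← hB, ← congrArg (fun S => ∑ k ∈ S, y k) (hσ (n + 1))]
    exact (Finset.sum_map _ σ.toEmbedding y).symm
  rw [h2] at h1
  linarith [hF2 (insert n (B n)) n]

/-! ### Unconditional bases of Hilbert spaces -/

section Riesz

variable {H : Type*} [NormedAddCommGroup H] [InnerProductSpace ℂ H]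

/-- Choosing signs greedily, the norm of a signed sum is at most what it is for an orthogonal
family. -/
theorem exists_sign_norm_sum_sq_le {ι : Type*} (S : Finset ι) (y : ι → H) :
    ∃ ε : ι → ℂ, (∀ k, ε k = 1 ∨ ε k = -1) ∧ ‖∑ k ∈ S, ε k • y k‖ ^ 2 ≤ ∑ k ∈ S, ‖y k‖ ^ 2 := by
  classical
  induction S using Finset.induction_on with
  | empty => exact ⟨fun _ => 1, by simp, by simp⟩
  | insert a S ha ih =>
    obtain ⟨ε, hε, h⟩ := ih
    set s := ∑ k ∈ S, ε k • y k with hs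
    obtain ⟨δ, hδ, hδs⟩ : ∃ δ : ℂ, (δ = 1 ∨ δ = -1) ∧ RCLike.re (inner ℂ (δ • y a) s) ≤ 0 := by
      rcases le_total (RCLike.re (inner ℂ (y a) s)) 0 with h0 | h0
      · exact ⟨1, .inl rfl, by simpa using h0⟩
      · exact ⟨-1, .inr rfl, by simpa using h0⟩
    refine ⟨Function.update ε a δ, fun k => ?_, ?_⟩
    · by_cases hk : k = a
      · subst hk; simpa using hδ
      · simpa [hk] using hε k
    · have h1 : ∑ k ∈ S, Function.update ε a δ k • y k = s :=
        Finset.sum_congr rfl fun k hk => by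
          rw [Function.update_of_ne fun h : k = a => ha (h ▸ hk)]
      have h2 : ‖δ • y a‖ = ‖y a‖ := by
        rcases hδ with rfl | rfl <;> simp
      rw [Finset.sum_insert ha, Finset.sum_insert ha, h1, Function.update_self,
        norm_add_sq (𝕜 := ℂ), h2]
      linarith

/-- Choosing signs greedily, the norm of a signed sum is at least what it is for an orthogonal
family. -/
theorem exists_sign_le_norm_sum_sq {ι : Type*} (S : Finset ι) (y : ι → H) :
    ∃ ε : ι → ℂ, (∀ k, ε k = 1 ∨ ε k = -1) ∧ ∑ k ∈ S, ‖y k‖ ^ 2 ≤ ‖∑ k ∈ S, ε k • y k‖ ^ 2 := by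
  classical
  induction S using Finset.induction_on with
  | empty => exact ⟨fun _ => 1, by simp, by simp⟩
  | insert a S ha ih =>
    obtain ⟨ε, hε, h⟩ := ih
    set s := ∑ k ∈ S, ε k • y k with hs
    obtain ⟨δ, hδ, hδs⟩ : ∃ δ : ℂ, (δ = 1 ∨ δ = -1) ∧ 0 ≤ RCLike.re (inner ℂ (δ • y a) s) := by
      rcases le_total 0 (RCLike.re (inner ℂ (y a) s)) with h0 | h0
      · exact ⟨1, .inl rfl, by simpa using h0⟩
      · exact ⟨-1, .inr rfl, by simpa using h0⟩
    refine ⟨Function.update ε a δ, fun k => ?_, ?_⟩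
    · by_cases hk : k = a
      · subst hk; simpa using hδ
      · simpa [hk] using hε k
    · have h1 : ∑ k ∈ S, Function.update ε a δ k • y k = s :=
        Finset.sum_congr rfl fun k hk => by
          rw [Function.update_of_ne fun h : k = a => ha (h ▸ hk)]
      have h2 : ‖δ • y a‖ = ‖y a‖ := by
        rcases hδ with rfl | rfl <;> simp
      rw [Finset.sum_insert ha, Finset.sum_insert ha, h1, Function.update_self,
        norm_add_sq (𝕜 := ℂ), h2]
      linarith

theorem seriesConvergesTo_sum (x : ℕ → H) (c : ℕ → ℂ) (S : Finset ℕ) :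
    SeriesConvergesTo (fun k => if k ∈ S then c k else 0) x (∑ k ∈ S, c k • x k) := by
  have h : HasSum (fun k => (if k ∈ S then c k else 0) • x k)
      (∑ k ∈ S, (if k ∈ S then c k else 0) • x k) :=
    hasSum_sum_of_ne_finset_zero fun k hk => by simp [hk]
  rw [Finset.sum_congr rfl (g := fun k => c k • x k) fun k hk => by simp [hk]] at h
  exact h.tendsto_sum_nat

/-- The partial expansions with respect to an unconditional basis are uniformly bounded operators,
by the uniform boundedness principle. -/
theorem IsUnconditionalBasis.exists_norm_sum_coord_le [CompleteSpace H] {x : ℕ → H}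
    (hx : IsUnconditionalBasis x) {φ : ℕ → H →L[ℂ] ℂ}
    (hφ : ∀ v c, SeriesConvergesTo c x v → ∀ n, φ n v = c n) :
    ∃ K, ∀ (S : Finset ℕ) (v : H), ‖∑ k ∈ S, φ k v • x k‖ ≤ K * ‖v‖ := by
  obtain ⟨K, hK⟩ := banach_steinhaus
    (g := fun S : Finset ℕ => ∑ k ∈ S, (φ k).smulRight (x k)) fun v => by
      obtain ⟨c, hc, -⟩ := hx.1 v
      obtain ⟨C, hC⟩ := exists_norm_sum_le_of_forall_perm_tendsto (y := fun k => c k • x k)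
        fun σ => ⟨v, hx.2 v c hc σ⟩
      refine ⟨C, fun S => ?_⟩
      simpa [_root_.sum_apply, hφ v c hc] using hC S
  refine ⟨K, fun S v => ?_⟩
  simpa [_root_.sum_apply] using
    (∑ k ∈ S, (φ k).smulRight (x k)).le_of_opNorm_le (hK S) v

/-- **Köthe–Toeplitz**: an unconditional basis of a Hilbert space, rescaled to unit vectors, is a
Riesz basis. Changing signs in an expansion costs a bounded factor, and some choice of signs makes
the norm of a sum comparable to the orthogonal one from either side. -/
theorem IsUnconditionalBasis.exists_riesz_bounds [CompleteSpace H] {x : ℕ → H}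
    (hx : IsUnconditionalBasis x) {φ : ℕ → H →L[ℂ] ℂ}
    (hφ : ∀ v c, SeriesConvergesTo c x v → ∀ n, φ n v = c n) :
    ∃ K, 0 ≤ K ∧ ∀ (S : Finset ℕ) (c : ℕ → ℂ),
      ∑ k ∈ S, ‖c k • x k‖ ^ 2 ≤ (K * ‖∑ k ∈ S, c k • x k‖) ^ 2 ∧
      ‖∑ k ∈ S, c k • x k‖ ^ 2 ≤ K ^ 2 * ∑ k ∈ S, ‖c k • x k‖ ^ 2 := by
  classical
  obtain ⟨K, hK⟩ := hx.exists_norm_sum_coord_le hφ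
  have hsign : ∀ (S : Finset ℕ) (c ε : ℕ → ℂ), (∀ k, ε k = 1 ∨ ε k = -1) →
      ‖∑ k ∈ S, ε k • (c k • x k)‖ ≤ 2 * |K| * ‖∑ k ∈ S, c k • x k‖ := by
    intro S c ε hε
    set v := ∑ k ∈ S, c k • x k with hv
    have hcoord : ∀ k ∈ S, φ k v = c k := fun k hk => by
      rw [hφ v _ (seriesConvergesTo_sum x c S) k, if_pos hk]
    have hsub : ∀ T ⊆ S, ‖∑ k ∈ T, c k • x k‖ ≤ |K| * ‖v‖ := fun T hT => by
      have h := hK T v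
      rw [Finset.sum_congr rfl fun k hk => by rw [hcoord k (hT hk)]] at h
      exact h.trans (by gcongr; exact le_abs_self K)
    have h1 := hsub _ (Finset.filter_subset (fun k => ε k = 1) S)
    have h2 := hsub _ (Finset.filter_subset (fun k => ¬ ε k = 1) S)
    have h3 : ∑ k ∈ S, ε k • (c k • x k) = ∑ k ∈ S with ε k = 1, c k • x k -
        ∑ k ∈ S with ¬ ε k = 1, c k • x k := by
      rw [← Finset.sum_filter_add_sum_filter_not S (fun k => ε k = 1), sub_eq_add_neg,
        ← Finset.sum_neg_distrib]
      congr 1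
      · exact Finset.sum_congr rfl fun k hk => by simp [(Finset.mem_filter.1 hk).2]
      · exact Finset.sum_congr rfl fun k hk => by
          simp [(hε k).resolve_left (Finset.mem_filter.1 hk).2]
    rw [h3]
    linarith [norm_sub_le (∑ k ∈ S with ε k = 1, c k • x k) (∑ k ∈ S with ¬ ε k = 1, c k • x k)]
  refine ⟨2 * |K|, by positivity, fun S c => ⟨?_, ?_⟩⟩
  · obtain ⟨ε, hε, h⟩ := exists_sign_le_norm_sum_sq S fun k => c k • x k
    exact h.trans (pow_le_pow_left₀ (norm_nonneg _) (hsign S c ε hε) 2)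
  · obtain ⟨ε, hε, h⟩ := exists_sign_norm_sum_sq_le S fun k => c k • x k
    have h1 := hsign S (fun k => ε k * c k) ε hε
    have h2 : ∀ k, ε k • (ε k * c k) • x k = c k • x k := fun k => by
      rcases hε k with h | h <;> simp [h]
    rw [Finset.sum_congr rfl fun k _ => h2 k] at h1
    simp only [mul_smul] at h1
    calc _ ≤ (2 * |K| * ‖∑ k ∈ S, ε k • c k • x k‖) ^ 2 := pow_le_pow_left₀ (norm_nonneg _) h1 2
      _ = (2 * |K|) ^ 2 * ‖∑ k ∈ S, ε k • c k • x k‖ ^ 2 := mul_pow _ _ _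
      _ ≤ _ := by gcongr

end Riesz

/-- If continuous functionals `ψ n` are triangular on `x`, with non-zero diagonal, then
the coefficients of any expansion in `x` are continuous functionals of the sum. -/
theorem exists_coord_of_triangular {H : Type*} [NormedAddCommGroup H] [NormedSpace ℂ H]
    {x : ℕ → H} (ψ : ℕ → H →L[ℂ] ℂ) (hψ : ∀ n k, n < k → ψ n (x k) = 0)
    (hψ' : ∀ n, ψ n (x n) ≠ 0) :
    ∃ φ : ℕ → H →L[ℂ] ℂ, ∀ v c, SeriesConvergesTo c x v → ∀ n, φ n v = c n := by
  suffices h : ∀ n, ∃ φ : H →L[ℂ] ℂ, ∀ v c, SeriesConvergesTo c x v → φ v = c n by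
    choose φ hφ using h
    exact ⟨φ, fun v c hc n => hφ n v c hc⟩
  intro n
  induction n using Nat.strong_induction_on with
  | _ n ih =>
    choose! φ hφ using ih
    refine ⟨(ψ n (x n))⁻¹ • (ψ n - ∑ k ∈ Finset.range n, ψ n (x k) • φ k), fun v c hc => ?_⟩
    have h1 : ψ n v = ∑ k ∈ Finset.range (n + 1), c k * ψ n (x k) := by
      refine tendsto_nhds_unique ((ψ n).continuous.tendsto v |>.comp hc) ?_
      refine tendsto_const_nhds.congr' ?_
      filter_upwards [eventually_ge_atTop (n + 1)] with N hN
      simp only [Function.comp, map_sum, map_smul, smul_eq_mul]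
      refine Finset.sum_subset (Finset.range_mono hN) fun k _ hk => ?_
      rw [hψ n k (by simpa using hk), mul_zero]
    have h2 : ∑ k ∈ Finset.range n, ψ n (x k) * φ k v = ∑ k ∈ Finset.range n, c k * ψ n (x k) :=
      Finset.sum_congr rfl fun k hk => by
        rw [hφ k (Finset.mem_range.1 hk) v c hc, mul_comm]
    simp only [FunLike.coe_smul, FunLike.coe_sub, Pi.smul_apply, Pi.sub_apply,
      _root_.sum_apply, smul_eq_mul, h2, h1, Finset.sum_range_succ, add_sub_cancel_left]
    field_simp [hψ' n]

/-! ### Multiplication operators on the infinite torus -/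

/-- Multiplication of `L²` functions by essentially bounded functions. -/
def mulLp : Lp ℂ ∞ rho →L[ℂ] Lp ℂ 2 rho →L[ℂ] Lp ℂ 2 rho :=
  (ContinuousLinearMap.mul ℂ ℂ).holderL rho ∞ 2 2

/-- Multiplication of `L²` functions by continuous functions. -/
def mulC : C(InfTorus, ℂ) →L[ℂ] Lp ℂ 2 rho →L[ℂ] Lp ℂ 2 rho :=
  mulLp ∘L ContinuousMap.toLp ∞ rho ℂ

theorem coeFn_mulLp (φ : Lp ℂ ∞ rho) (F : Lp ℂ 2 rho) :
    mulLp φ F =ᵐ[rho] fun ζ => φ ζ * F ζ :=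
  (ContinuousLinearMap.mul ℂ ℂ).coeFn_holder φ F

theorem coeFn_mulC (g : C(InfTorus, ℂ)) (F : Lp ℂ 2 rho) :
    mulC g F =ᵐ[rho] fun ζ => g ζ * F ζ := by
  filter_upwards [coeFn_mulLp (ContinuousMap.toLp ∞ rho ℂ g) F,
    ContinuousMap.coeFn_toLp (p := ∞) (𝕜 := ℂ) rho g] with ζ h1 h2
  rw [← h2]
  exact h1

theorem mulC_mul (g h : C(InfTorus, ℂ)) (F : Lp ℂ 2 rho) :
    mulC (g * h) F = mulC g (mulC h F) := by
  apply Lp.ext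
  filter_upwards [coeFn_mulC (g * h) F, coeFn_mulC g (mulC h F), coeFn_mulC h F] with ζ h1 h2 h3
  rw [h1, h2, h3, ContinuousMap.mul_apply, mul_assoc]

theorem mulC_toLp (g h : C(InfTorus, ℂ)) :
    mulC g (ContinuousMap.toLp 2 rho ℂ h) = ContinuousMap.toLp 2 rho ℂ (g * h) := by
  apply Lp.ext
  filter_upwards [coeFn_mulC g (ContinuousMap.toLp 2 rho ℂ h),
    ContinuousMap.coeFn_toLp (p := 2) (𝕜 := ℂ) rho h,
    ContinuousMap.coeFn_toLp (p := 2) (𝕜 := ℂ) rho (g * h)] with ζ h1 h2 h3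
  rw [h1, h2, h3, ContinuousMap.mul_apply]

theorem mulLp_mulC (φ : Lp ℂ ∞ rho) (g : C(InfTorus, ℂ)) (F : Lp ℂ 2 rho) :
    mulLp φ (mulC g F) = mulC g (mulLp φ F) := by
  apply Lp.ext
  filter_upwards [coeFn_mulLp φ (mulC g F), coeFn_mulC g F, coeFn_mulC g (mulLp φ F),
    coeFn_mulLp φ F] with ζ h1 h2 h3 h4
  rw [h1, h2, h3, h4, mul_left_comm]

theorem norm_mulC_of_norm_eq_one {g : C(InfTorus, ℂ)} (hg : ∀ ζ, ‖g ζ‖ = 1) (F : Lp ℂ 2 rho) :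
    ‖mulC g F‖ = ‖F‖ := by
  rw [Lp.norm_def, Lp.norm_def]
  congr 1
  refine eLpNorm_congr_norm_ae ?_
  filter_upwards [coeFn_mulC g F] with ζ h1
  rw [h1, norm_mul, hg, one_mul]

theorem norm_monomial (α : ℕ →₀ ℕ) (ζ : InfTorus) : ‖monomial α ζ‖ = 1 := by
  simp [monomial, norm_prod, Circle.norm_coe]

theorem monomial_eq_prod {α : ℕ →₀ ℕ} {s : Finset ℕ} (hs : α.support ⊆ s) (ζ : InfTorus) :
    monomial α ζ = ∏ j ∈ s, (ζ j : ℂ) ^ α j :=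
  Finset.prod_subset hs fun i _ hi => by simp [Finsupp.notMem_support_iff.1 hi]

theorem monomial_add (α β : ℕ →₀ ℕ) : monomial (α + β) = monomial α * monomial β := by
  ext ζ
  have h := Finsupp.support_add (g₁ := α) (g₂ := β)
  rw [ContinuousMap.mul_apply, monomial_eq_prod h, monomial_eq_prod Finset.subset_union_left,
    monomial_eq_prod (α := β) Finset.subset_union_right, ← Finset.prod_mul_distrib]
  simp [pow_add]

theorem monomial_zero : monomial 0 = 1 := by
  ext ζ
  simp [monomial]

theorem star_monomial_mul (α : ℕ →₀ ℕ) : star (monomial α) * monomial α = 1 := by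
  ext ζ
  simp [Complex.conj_mul', norm_monomial]

theorem monomial_single (j : ℕ) (ζ : InfTorus) : monomial (Finsupp.single j 1) ζ = ζ j := by
  simp [monomial_eq_prod (Finsupp.support_single_subset (a := j) (b := 1))]

/-- The analytic polynomials in the coordinates of the infinite torus. -/
def analyticPoly : Submodule ℂ C(InfTorus, ℂ) := Submodule.span ℂ (Set.range monomial)

theorem monomial_mem (α : ℕ →₀ ℕ) : monomial α ∈ analyticPoly := Submodule.subset_span ⟨α, rfl⟩

theorem mul_mem_analyticPoly {p q : C(InfTorus, ℂ)} (hp : p ∈ analyticPoly)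
    (hq : q ∈ analyticPoly) : p * q ∈ analyticPoly := by
  have h : analyticPoly * analyticPoly ≤ analyticPoly := by
    rw [analyticPoly, Submodule.span_mul_span, Submodule.span_le]
    rintro _ ⟨_, ⟨α, rfl⟩, _, ⟨β, rfl⟩, rfl⟩
    change monomial α * monomial β ∈ analyticPoly
    rw [← monomial_add]
    exact monomial_mem _
  exact h (Submodule.mul_mem_mul hp hq)

/-- The trigonometric polynomials, encoded as the quotients of analytic polynomials by
monomials. -/
def trigPoly : StarSubalgebra ℂ C(InfTorus, ℂ) where
  carrier := {g | ∃ β, g * monomial β ∈ analyticPoly}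
  mul_mem' := by
    rintro g h ⟨β, hg⟩ ⟨γ, hh⟩
    refine ⟨β + γ, ?_⟩
    rw [monomial_add, mul_mul_mul_comm]
    exact mul_mem_analyticPoly hg hh
  add_mem' := by
    rintro g h ⟨β, hg⟩ ⟨γ, hh⟩
    refine ⟨β + γ, ?_⟩
    rw [monomial_add, add_mul, ← mul_assoc, mul_comm (monomial β), ← mul_assoc h]
    exact add_mem (mul_mem_analyticPoly hg (monomial_mem γ))
      (mul_mem_analyticPoly hh (monomial_mem β))
  algebraMap_mem' c := ⟨0, by
    rw [Algebra.algebraMap_eq_smul_one, smul_mul_assoc, one_mul]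
    exact Submodule.smul_mem _ _ (monomial_mem 0)⟩
  star_mem' := by
    rintro g ⟨β, hg⟩
    -- It suffices to treat `star p` for the analytic polynomial `p = g * monomial β`.
    suffices h : ∃ γ, star (g * monomial β) * monomial γ ∈ analyticPoly by
      obtain ⟨γ, hγ⟩ := h
      refine ⟨γ, ?_⟩
      have h1 : star g * monomial γ = monomial β * (star (g * monomial β) * monomial γ) := by
        calc star g * monomial γ
            = star g * monomial γ * (star (monomial β) * monomial β) := by
              rw [star_monomial_mul, mul_one]
          _ = _ := by rw [star_mul]; ring
      rw [h1]
      exact mul_mem_analyticPoly (monomial_mem β) hγ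
    generalize g * monomial β = p at hg
    induction hg using Submodule.span_induction with
    | mem p hp =>
      obtain ⟨α, rfl⟩ := hp
      exact ⟨α, by rw [star_monomial_mul, ← monomial_zero]; exact monomial_mem 0⟩
    | zero => exact ⟨0, by simp⟩
    | add p q _ _ hp hq =>
      obtain ⟨β, hp⟩ := hp
      obtain ⟨γ, hq⟩ := hq
      refine ⟨β + γ, ?_⟩
      rw [monomial_add, star_add, add_mul, ← mul_assoc, mul_comm (monomial β), ← mul_assoc (star q)]
      exact add_mem (mul_mem_analyticPoly hp (monomial_mem γ))
        (mul_mem_analyticPoly hq (monomial_mem β))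
    | smul c p _ hp =>
      obtain ⟨β, hp⟩ := hp
      exact ⟨β, by rw [star_smul, smul_mul_assoc]; exact Submodule.smul_mem _ _ hp⟩

/-- Stone–Weierstrass on the infinite torus. -/
theorem trigPoly_topologicalClosure : trigPoly.topologicalClosure = ⊤ := by
  refine ContinuousMap.starSubalgebra_topologicalClosure_eq_top_of_separatesPoints _ ?_
  intro ζ η h
  obtain ⟨j, hj⟩ := Function.ne_iff.1 h
  refine ⟨_, ⟨monomial (Finsupp.single j 1), ⟨0, ?_⟩, rfl⟩, ?_⟩
  · rw [monomial_zero, mul_one]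
    exact monomial_mem _
  · simp only [monomial_single]
    exact fun h => hj (Circle.coe_injective h)

/-- A bound for multiplication by `F` on analytic polynomials holds on all continuous functions:
dividing a polynomial by a monomial changes no norm, and trigonometric polynomials are dense. -/
theorem norm_mulC_le_of_analyticPoly {F : Lp ℂ 2 rho} {C : ℝ}
    (h : ∀ p ∈ analyticPoly, ‖mulC p F‖ ≤ C * ‖ContinuousMap.toLp 2 rho ℂ p‖)
    (g : C(InfTorus, ℂ)) : ‖mulC g F‖ ≤ C * ‖ContinuousMap.toLp 2 rho ℂ g‖ := by
  have hclosed : IsClosed {g : C(InfTorus, ℂ) |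
      ‖mulC g F‖ ≤ C * ‖ContinuousMap.toLp 2 rho ℂ g‖} := by
    have h1 : Continuous fun g : C(InfTorus, ℂ) => mulC g F := by fun_prop
    have h2 : Continuous fun g : C(InfTorus, ℂ) => ContinuousMap.toLp 2 rho ℂ g :=
      (ContinuousMap.toLp 2 rho ℂ).continuous
    exact isClosed_le h1.norm (continuous_const.mul h2.norm)
  have hsub : (trigPoly : Set C(InfTorus, ℂ)) ⊆ {g : C(InfTorus, ℂ) |
      ‖mulC g F‖ ≤ C * ‖ContinuousMap.toLp 2 rho ℂ g‖} := by
    rintro g ⟨β, hg⟩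
    have h1 := h _ hg
    rwa [mul_comm g, mulC_mul, norm_mulC_of_norm_eq_one (norm_monomial β), ← mulC_toLp,
      norm_mulC_of_norm_eq_one (norm_monomial β)] at h1
  have h2 : g ∈ trigPoly.topologicalClosure := by
    rw [trigPoly_topologicalClosure]; trivial
  exact closure_minimal hsub hclosed h2

instance : rho.Regular := by unfold rho; infer_instance

/-- A function that multiplies the continuous functions boundedly in `L²` norm is essentially
bounded: test on continuous approximations of indicator functions and apply Fatou's lemma. -/
theorem ae_norm_le_of_norm_mulC_le {F : Lp ℂ 2 rho} {C : ℝ} (hC : 0 ≤ C)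
    (h : ∀ g : C(InfTorus, ℂ), ‖mulC g F‖ ≤ C * ‖ContinuousMap.toLp 2 rho ℂ g‖) :
    ∀ᵐ ζ ∂rho, ‖F ζ‖ ≤ C := by
  have key : ∀ A, MeasurableSet A →
      eLpNorm (A.indicator F) 2 rho ≤
        ENNReal.ofReal C * eLpNorm (A.indicator fun _ => (1 : ℂ)) 2 rho := by
    intro A hA
    set u : Lp ℂ 2 rho := indicatorConstLp 2 hA (measure_ne_top rho A) (1 : ℂ) with hu
    have hdense := ContinuousMap.toLp_denseRange (p := 2) ℂ rho ℂ (by norm_num)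
    obtain ⟨x, hx, hxu⟩ := mem_closure_iff_seq_limit.1 (hdense u)
    choose g hg using hx
    obtain ⟨ns, hns, hae⟩ := (tendstoInMeasure_of_tendsto_Lp hxu).exists_seq_tendsto_ae
    have hlim : ∀ᵐ ζ ∂rho, Tendsto (fun i => mulC (g (ns i)) F ζ) atTop
        (𝓝 (A.indicator F ζ)) := by
      have h1 : ∀ᵐ ζ ∂rho, ∀ i, mulC (g (ns i)) F ζ = x (ns i) ζ * F ζ := by
        rw [ae_all_iff]
        intro i
        filter_upwards [coeFn_mulC (g (ns i)) F,
          ContinuousMap.coeFn_toLp (p := 2) (𝕜 := ℂ) rho (g (ns i))] with ζ h2 h3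
        rw [h2, ← hg, h3]
      filter_upwards [h1, hae, indicatorConstLp_coeFn (p := 2) (hs := hA)
        (hμs := measure_ne_top rho A) (c := (1 : ℂ))] with ζ h2 h3 h4
      simp only [h2]
      convert h3.mul_const (F ζ) using 2
      rw [hu, h4]
      by_cases hζ : ζ ∈ A <;> simp [hζ]
    have hnorm : ∀ i, eLpNorm (mulC (g (ns i)) F) 2 rho ≤
        ENNReal.ofReal (C * ‖x (ns i)‖) := by
      intro i
      rw [← Lp.enorm_def, ← ofReal_norm]
      exact ENNReal.ofReal_le_ofReal (hg (ns i) ▸ h (g (ns i)))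
    have hrhs : Tendsto (fun i => ENNReal.ofReal (C * ‖x (ns i)‖)) atTop
        (𝓝 (ENNReal.ofReal (C * ‖u‖))) :=
      ENNReal.tendsto_ofReal ((hxu.comp hns.tendsto_atTop).norm.const_mul C)
    refine (Lp.eLpNorm_lim_le_liminf_eLpNorm (fun i => Lp.aestronglyMeasurable _) _ hlim).trans ?_
    refine (liminf_le_liminf (Eventually.of_forall hnorm)).trans ?_
    rw [hrhs.liminf_eq, ENNReal.ofReal_mul hC, ofReal_norm, Lp.enorm_def]
    gcongr
    exact (eLpNorm_congr_ae indicatorConstLp_coeFn).le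
  have h2 : ∀ᵐ ζ ∂rho, ‖F ζ‖ₑ ^ 2 ≤ ENNReal.ofReal C ^ 2 := by
    refine ae_le_of_forall_setLIntegral_le_of_sigmaFinite₀
      ((Lp.aestronglyMeasurable F).enorm.pow_const 2) fun A hA _ => ?_
    have h3 := pow_le_pow_left₀ (zero_le) (key A hA) 2
    have h4 : ∀ w : InfTorus → ℂ, eLpNorm (A.indicator w) 2 rho ^ 2 =
        ∫⁻ ζ in A, ‖w ζ‖ₑ ^ 2 ∂rho := by
      intro w
      rw [eLpNorm_indicator_eq_eLpNorm_restrict hA,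
        eLpNorm_eq_lintegral_rpow_enorm_toReal (by norm_num) (by norm_num)]
      rw [← ENNReal.rpow_natCast, ← ENNReal.rpow_mul]
      simp
    rw [mul_pow, h4, h4] at h3
    simpa using h3
  filter_upwards [h2] with ζ hζ
  rw [← ofReal_norm, ← ENNReal.ofReal_pow (norm_nonneg _), ← ENNReal.ofReal_pow hC,
    ENNReal.ofReal_le_ofReal_iff (by positivity)] at hζ
  exact abs_le_of_sq_le_sq' hζ hC |>.2

/-! ### Stability of unconditional bases -/

section Stability

variable {H H' : Type*} [NormedAddCommGroup H] [NormedSpace ℂ H] [NormedAddCommGroup H']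
  [NormedSpace ℂ H']

theorem seriesConvergesTo_map_iff (L : H ≃L[ℂ] H') (c : ℕ → ℂ) (x : ℕ → H) (v : H) :
    SeriesConvergesTo c (fun k => L (x k)) (L v) ↔ SeriesConvergesTo c x v := by
  have h := L.toHomeomorph.isInducing.tendsto_nhds_iff
    (f := fun N => ∑ k ∈ Finset.range N, c k • x k) (l := atTop) (y := v)
  unfold SeriesConvergesTo
  rw [h]
  refine tendsto_congr fun N => ?_
  simp

theorem IsUnconditionalBasis.map {x : ℕ → H} (hx : IsUnconditionalBasis x) (L : H ≃L[ℂ] H') :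
    IsUnconditionalBasis fun k => L (x k) := by
  refine ⟨fun w => ?_, fun w c hc σ => ?_⟩
  · obtain ⟨v, rfl⟩ := L.surjective w
    simpa only [seriesConvergesTo_map_iff] using hx.1 v
  · obtain ⟨v, rfl⟩ := L.surjective w
    rw [seriesConvergesTo_map_iff] at hc
    exact (seriesConvergesTo_map_iff L _ _ v).2 (hx.2 v c hc σ)

theorem isUnconditionalBasis_map_iff {x : ℕ → H} (L : H ≃L[ℂ] H') :
    (IsUnconditionalBasis fun k => L (x k)) ↔ IsUnconditionalBasis x :=
  ⟨fun h => by simpa using h.map L.symm, fun h => h.map L⟩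

theorem seriesConvergesTo_smul_iff (a c : ℕ → ℂ) (x : ℕ → H) (v : H) :
    SeriesConvergesTo c (fun k => a k • x k) v ↔ SeriesConvergesTo (fun k => c k * a k) x v := by
  simp only [SeriesConvergesTo, mul_smul]

theorem IsUnconditionalBasis.smul {x : ℕ → H} (hx : IsUnconditionalBasis x) {a : ℕ → ℂ}
    (ha : ∀ k, a k ≠ 0) : IsUnconditionalBasis fun k => a k • x k := by
  refine ⟨fun v => ?_, fun v c hc σ => ?_⟩
  · obtain ⟨c, hc, huniq⟩ := hx.1 v
    refine ⟨fun k => c k / a k, ?_, fun d hd => ?_⟩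
    · simpa [seriesConvergesTo_smul_iff, ha] using hc
    · have := huniq _ ((seriesConvergesTo_smul_iff a d x v).1 hd)
      funext k
      rw [← this, mul_div_cancel_right₀ _ (ha k)]
  · exact (seriesConvergesTo_smul_iff (a ∘ σ) _ _ v).2
      (hx.2 v _ ((seriesConvergesTo_smul_iff a c x v).1 hc) σ)

theorem isUnconditionalBasis_smul_iff {x : ℕ → H} {a : ℕ → ℂ} (ha : ∀ k, a k ≠ 0) :
    (IsUnconditionalBasis fun k => a k • x k) ↔ IsUnconditionalBasis x :=
  ⟨fun h => by simpa [smul_smul, ha] using h.smul fun k => inv_ne_zero (ha k), fun h => h.smul ha⟩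

end Stability

theorem isUnconditionalBasis_hilbertBasis {H : Type*} [NormedAddCommGroup H]
    [InnerProductSpace ℂ H] (b : HilbertBasis ℕ ℂ H) : IsUnconditionalBasis fun k => b k := by
  have huniq : ∀ v c, SeriesConvergesTo c (fun k => b k) v → c = b.repr v := by
    intro v c hc
    funext n
    rw [b.repr_apply_apply]
    refine tendsto_nhds_unique (tendsto_const_nhds.congr' ?_)
      ((innerSL ℂ (b n)).continuous.tendsto v |>.comp hc)
    filter_upwards [eventually_gt_atTop n] with N hN
    simp [inner_sum, inner_smul_right, orthonormal_iff_ite.1 b.orthonormal, hN]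
  refine ⟨fun v => ⟨b.repr v, (b.hasSum_repr v).tendsto_sum_nat, huniq v⟩, fun v c hc σ => ?_⟩
  obtain rfl := huniq v c hc
  exact (σ.hasSum_iff.2 (b.hasSum_repr v)).tendsto_sum_nat

/-! ### Prime exponents -/

theorem primeExponents_mul (m n : ℕ+) :
    primeExponents (m * n) = primeExponents m + primeExponents n := by
  ext j
  simp [primeExponents, Nat.factorization_mul m.ne_zero n.ne_zero]

theorem primeExponents_one : primeExponents 1 = 0 := by
  ext j
  simp [primeExponents]

theorem primeExponents_surjective : Function.Surjective primeExponents := by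
  intro α
  induction α using Finsupp.induction_linear with
  | zero => exact ⟨1, primeExponents_one⟩
  | add α β hα hβ =>
    obtain ⟨m, rfl⟩ := hα
    obtain ⟨n, rfl⟩ := hβ
    exact ⟨m * n, primeExponents_mul m n⟩
  | single j a =>
    have hp : (Nat.nth Nat.Prime j).Prime := Nat.prime_nth_prime j
    refine ⟨⟨Nat.nth Nat.Prime j ^ a, pow_pos hp.pos a⟩, ?_⟩
    ext i
    simp only [primeExponents, PNat.mk_coe, Finsupp.comapDomain_apply, hp.factorization_pow]
    by_cases hij : j = i
    · subst hij; simp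
    · rw [Finsupp.single_eq_of_ne (Ne.symm hij), Finsupp.single_eq_of_ne]
      exact fun h => hij (Nat.nth_injective Nat.infinite_setOfPred_prime h).symm

theorem primeExponents_bijective : Function.Bijective primeExponents :=
  ⟨primeExponents_injective, primeExponents_surjective⟩

theorem primeExponents_succPNat_bijective :
    Function.Bijective fun k : ℕ => primeExponents k.succPNat :=
  primeExponents_bijective.comp Equiv.pnatEquivNat.symm.bijective

/-! ### Multiplication operators on the Hardy space of the infinite torus -/

theorem map_mem_hardyH2 {T : Lp ℂ 2 rho →L[ℂ] Lp ℂ 2 rho} (hT : ∀ α, T (monomialL2 α) ∈ hardyH2)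
    {F : Lp ℂ 2 rho} (hF : F ∈ hardyH2) : T F ∈ hardyH2 := by
  have h : hardyH2 ≤ hardyH2.comap (T : Lp ℂ 2 rho →ₗ[ℂ] Lp ℂ 2 rho) := by
    refine Submodule.topologicalClosure_minimal _ (Submodule.span_le.2 ?_) ?_
    · rintro _ ⟨α, rfl⟩
      exact hT α
    · exact (Submodule.isClosed_topologicalClosure _).preimage T.continuous
  exact h hF

theorem mulC_monomialL2 (g : C(InfTorus, ℂ)) (α : ℕ →₀ ℕ) :
    mulC g (monomialL2 α) = ContinuousMap.toLp 2 rho ℂ (g * monomial α) := mulC_toLp g _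

theorem mulC_monomial_mem_hardyH2 (α : ℕ →₀ ℕ) {F : Lp ℂ 2 rho} (hF : F ∈ hardyH2) :
    mulC (monomial α) F ∈ hardyH2 :=
  map_mem_hardyH2 (fun β => by
    rw [mulC_monomialL2, ← monomial_add]
    exact (monomialH2 (α + β)).2) hF

/-- Multiplication by the monomial `ζ^α` on `H²(𝕋^∞)`. -/
def shift (α : ℕ →₀ ℕ) : hardyH2 →L[ℂ] hardyH2 :=
  (mulC (monomial α) ∘L hardyH2.subtypeL).codRestrict hardyH2
    fun F => mulC_monomial_mem_hardyH2 α F.2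

theorem coe_shift (α : ℕ →₀ ℕ) (F : hardyH2) :
    (shift α F : Lp ℂ 2 rho) = mulC (monomial α) F := rfl

theorem norm_shift (α : ℕ →₀ ℕ) (F : hardyH2) : ‖shift α F‖ = ‖F‖ :=
  norm_mulC_of_norm_eq_one (norm_monomial α) _

theorem shift_monomialH2 (α β : ℕ →₀ ℕ) : shift α (monomialH2 β) = monomialH2 (α + β) := by
  apply Subtype.ext
  rw [coe_shift]
  change mulC (monomial α) (monomialL2 β) = monomialL2 (α + β)
  rw [mulC_monomialL2, ← monomial_add]
  rfl

theorem dense_span_monomialH2 :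
    Dense (Submodule.span ℂ (Set.range monomialH2) : Set hardyH2) := by
  intro F
  rw [closure_subtype]
  have h : Subtype.val '' (Submodule.span ℂ (Set.range monomialH2) : Set hardyH2) =
      (Submodule.span ℂ (Set.range monomialL2) : Set (Lp ℂ 2 rho)) := by
    have h1 := Submodule.map_span hardyH2.subtype (Set.range monomialH2)
    rw [← Set.range_comp] at h1
    exact congrArg (fun M : Submodule ℂ (Lp ℂ 2 rho) => (M : Set (Lp ℂ 2 rho))) h1
  rw [h]
  exact F.2

theorem hardyH2_ext {E : Type*} [NormedAddCommGroup E] [NormedSpace ℂ E] {S T : hardyH2 →L[ℂ] E}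
    (h : ∀ α, S (monomialH2 α) = T (monomialH2 α)) : S = T :=
  ContinuousLinearMap.ext_on dense_span_monomialH2 (by rintro _ ⟨α, rfl⟩; exact h α)

/-- The monomials, listed by a bijection `e` onto the multi-indices, as a Hilbert basis of
`H²(𝕋^∞)`. -/
def monomialBasis {ι : Type*} (e : ι → ℕ →₀ ℕ) (he : Function.Bijective e) :
    HilbertBasis ι ℂ hardyH2 :=
  HilbertBasis.mk (orthonormal_monomialH2.comp e he.1) (by
    rw [he.2.range_comp]
    exact (Submodule.dense_iff_topologicalClosure_eq_top.1 dense_span_monomialH2).ge)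

theorem monomialBasis_apply {ι : Type*} {e : ι → ℕ →₀ ℕ} (he : Function.Bijective e) (i : ι) :
    monomialBasis e he i = monomialH2 (e i) := by
  simp [monomialBasis]

theorem inner_shift_eq_zero {α γ : ℕ →₀ ℕ} (h : ∀ β, α + β ≠ γ) (F : hardyH2) :
    inner ℂ (monomialH2 γ) (shift α F) = 0 := by
  have h1 : innerSL ℂ (monomialH2 γ) ∘L shift α = 0 := hardyH2_ext fun β => by
    simpa [shift_monomialH2] using orthonormal_monomialH2.2 (h β).symm
  exact DFunLike.congr_fun h1 F

theorem inner_shift_self (α : ℕ →₀ ℕ) (F : hardyH2) :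
    inner ℂ (monomialH2 α) (shift α F) = inner ℂ (monomialH2 0) F := by
  have h1 : innerSL ℂ (monomialH2 α) ∘L shift α = innerSL ℂ (monomialH2 0) :=
    hardyH2_ext fun β => by
      simp [shift_monomialH2, orthonormal_iff_ite.1 orthonormal_monomialH2, eq_comm]
  exact DFunLike.congr_fun h1 F

/-- A bounded function in `H²(𝕋^∞)`, as an element of `L^∞`. -/
def toLInf (F : hardyH2) (hF : F ∈ hardyHInf) : Lp ℂ ∞ rho :=
  MemLp.toLp (F : Lp ℂ 2 rho) ⟨Lp.aestronglyMeasurable _, hF⟩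

theorem mulLp_toLInf_monomialL2 {F : hardyH2} (hF : F ∈ hardyHInf) (α : ℕ →₀ ℕ) :
    mulLp (toLInf F hF) (monomialL2 α) = shift α F := by
  rw [coe_shift]
  apply Lp.ext
  filter_upwards [coeFn_mulLp (toLInf F hF) (monomialL2 α), coeFn_mulC (monomial α) F,
    MemLp.coeFn_toLp (f := (F : Lp ℂ 2 rho)) ⟨Lp.aestronglyMeasurable _, hF⟩,
    ContinuousMap.coeFn_toLp (p := 2) (𝕜 := ℂ) rho (monomial α)] with ζ h1 h2 h3 h4
  rw [h1, h2, toLInf, h3, monomialL2, h4, mul_comm]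

/-- Multiplication by a function in `H^∞(𝕋^∞)` on `H²(𝕋^∞)`. -/
def mulH2 (F : hardyH2) (hF : F ∈ hardyHInf) : hardyH2 →L[ℂ] hardyH2 :=
  (mulLp (toLInf F hF) ∘L hardyH2.subtypeL).codRestrict hardyH2 fun h =>
    map_mem_hardyH2 (fun α => by
      rw [mulLp_toLInf_monomialL2]
      exact (shift α F).2) h.2

theorem coeFn_mulH2 {F : hardyH2} (hF : F ∈ hardyHInf) (h : hardyH2) :
    (mulH2 F hF h : Lp ℂ 2 rho) =ᵐ[rho]
      fun ζ => (F : Lp ℂ 2 rho) ζ * (h : Lp ℂ 2 rho) ζ := by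
  filter_upwards [coeFn_mulLp (toLInf F hF) h,
    MemLp.coeFn_toLp (f := (F : Lp ℂ 2 rho)) ⟨Lp.aestronglyMeasurable _, hF⟩] with ζ h1 h3
  rw [← h3]
  exact h1

theorem mulH2_monomialH2 {F : hardyH2} (hF : F ∈ hardyHInf) (α : ℕ →₀ ℕ) :
    mulH2 F hF (monomialH2 α) = shift α F :=
  Subtype.ext (mulLp_toLInf_monomialL2 hF α)

theorem mulH2_shift {F : hardyH2} (hF : F ∈ hardyHInf) (α : ℕ →₀ ℕ) (h : hardyH2) :
    mulH2 F hF (shift α h) = shift α (mulH2 F hF h) :=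
  Subtype.ext (mulLp_mulC _ _ _)

theorem coeFn_monomialH2_zero : (monomialH2 0 : Lp ℂ 2 rho) =ᵐ[rho] fun _ => 1 := by
  have h : (monomialH2 0 : Lp ℂ 2 rho) = ContinuousMap.toLp 2 rho ℂ 1 := by
    rw [← monomial_zero]; rfl
  rw [h]
  exact ContinuousMap.coeFn_toLp (p := 2) (𝕜 := ℂ) rho 1

theorem mulH2_eq_one_iff {F G : hardyH2} (hF : F ∈ hardyHInf) :
    mulH2 F hF G = monomialH2 0 ↔
      ∀ᵐ ζ ∂rho, (F : Lp ℂ 2 rho) ζ * (G : Lp ℂ 2 rho) ζ = 1 := by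
  rw [Subtype.ext_iff, Lp.ext_iff]
  constructor
  · intro h
    filter_upwards [h, coeFn_mulH2 hF G, coeFn_monomialH2_zero] with ζ h1 h2 h3
    rw [← h2, h1, h3]
  · intro h
    filter_upwards [h, coeFn_mulH2 hF G, coeFn_monomialH2_zero] with ζ h1 h2 h3
    rw [h2, h1, h3]

theorem mulH2_mulH2_of_mul_eq_one {F G : hardyH2} (hF : F ∈ hardyHInf) (hG : G ∈ hardyHInf)
    (h : ∀ᵐ ζ ∂rho, (F : Lp ℂ 2 rho) ζ * (G : Lp ℂ 2 rho) ζ = 1) (v : hardyH2) :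
    mulH2 F hF (mulH2 G hG v) = v := by
  apply Subtype.ext
  apply Lp.ext
  filter_upwards [h, coeFn_mulH2 hF (mulH2 G hG v), coeFn_mulH2 hG v] with ζ h1 h2 h3
  rw [h2, h3, ← mul_assoc, h1, one_mul]

/-! ### Unconditional bases of monomial multiples -/

/-- An invertible `F ∈ H^∞` multiplies the orthonormal basis of monomials to an unconditional
basis. -/
theorem isUnconditionalBasis_shift_of_invertible {F : hardyH2} (hF : IsInvertibleInHInf F) :
    IsUnconditionalBasis fun k : ℕ => shift (primeExponents k.succPNat) F := by
  obtain ⟨hF, G, hG, hFG⟩ := hF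
  have hGF : ∀ᵐ ζ ∂rho, (G : Lp ℂ 2 rho) ζ * (F : Lp ℂ 2 rho) ζ = 1 := by
    simpa only [mul_comm] using hFG
  let L : hardyH2 ≃L[ℂ] hardyH2 := ContinuousLinearEquiv.equivOfInverse (mulH2 F hF) (mulH2 G hG)
    (mulH2_mulH2_of_mul_eq_one hG hF hGF) (mulH2_mulH2_of_mul_eq_one hF hG hFG)
  have h := (isUnconditionalBasis_hilbertBasis
    (monomialBasis _ primeExponents_succPNat_bijective)).map L
  convert h using 2 with k
  rw [monomialBasis_apply]
  exact (mulH2_monomialH2 hF _).symm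

theorem inner_monomialH2_shift_of_lt (F : hardyH2) {n k : ℕ} (h : n < k) :
    inner ℂ (monomialH2 (primeExponents n.succPNat))
      (shift (primeExponents k.succPNat) F) = 0 := by
  refine inner_shift_eq_zero (fun β hβ => ?_) F
  obtain ⟨m, rfl⟩ := primeExponents_surjective β
  rw [← primeExponents_mul] at hβ
  have h1 : k.succPNat * m = n.succPNat := primeExponents_injective hβ
  have h2 : (k + 1) * (m : ℕ) = n + 1 := by simpa using congrArg PNat.val h1
  nlinarith [m.pos]

/-- The constant term of `F` is non-zero when the monomial multiples of `F` form a basis: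
otherwise all of them, and hence the constant function `1`, would have zero constant term. -/
theorem IsSchauderBasis.inner_monomialH2_zero_ne {F : hardyH2}
    (hx : IsSchauderBasis fun k : ℕ => shift (primeExponents k.succPNat) F) :
    inner ℂ (monomialH2 0) F ≠ 0 := by
  intro h0
  obtain ⟨c, hc, -⟩ := hx (monomialH2 0)
  have hz : ∀ k : ℕ, inner ℂ (monomialH2 0) (shift (primeExponents k.succPNat) F) = 0 := by
    have h1 : primeExponents (Nat.succPNat 0) = 0 := primeExponents_one
    intro k
    rcases k.eq_zero_or_pos with rfl | hk
    · rw [h1, inner_shift_self, h0]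
    · rw [← inner_monomialH2_shift_of_lt F hk, h1]
  have h1 := ((innerSL ℂ (monomialH2 0)).continuous.tendsto _).comp hc
  have h2 : (innerSL ℂ (monomialH2 0)) (monomialH2 0) = 0 :=
    tendsto_nhds_unique h1 (tendsto_const_nhds.congr fun N => by
      simp only [Function.comp, innerSL_apply_apply, inner_sum, inner_smul_right, hz, mul_zero,
        Finset.sum_const_zero])
  have h3 := orthonormal_monomialH2.1 0
  rw [innerSL_apply_apply, inner_self_eq_zero] at h2
  simp [h2] at h3

theorem mem_analyticPoly_iff {p : C(InfTorus, ℂ)} : p ∈ analyticPoly ↔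
    ∃ (S : Finset ℕ) (c : ℕ → ℂ), p = ∑ k ∈ S, c k • monomial (primeExponents k.succPNat) := by
  have h : Set.range monomial = Set.range fun k : ℕ => monomial (primeExponents k.succPNat) :=
    (primeExponents_succPNat_bijective.2.range_comp monomial).symm
  rw [analyticPoly, h, ← Set.image_univ, Submodule.mem_span_image_iff_exists_fun]
  constructor
  · rintro ⟨t, -, c, hc⟩
    refine ⟨t, fun k => if h : k ∈ t then c ⟨k, h⟩ else 0, ?_⟩
    rw [← hc, ← Finset.sum_coe_sort t]
    simp
  · rintro ⟨S, c, rfl⟩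
    exact ⟨S, Set.subset_univ _, fun k => c k,
      Finset.sum_coe_sort S fun k => c k • monomial (primeExponents k.succPNat)⟩

theorem toLp_sum_monomial (S : Finset ℕ) (c : ℕ → ℂ) :
    ContinuousMap.toLp 2 rho ℂ (∑ k ∈ S, c k • monomial (primeExponents k.succPNat)) =
      ((∑ k ∈ S, c k • monomialH2 (primeExponents k.succPNat) : hardyH2) : Lp ℂ 2 rho) := by
  simp only [map_sum, map_smul, Submodule.coe_sum, Submodule.coe_smul]
  rfl

theorem norm_toLp_sum_sq (S : Finset ℕ) (c : ℕ → ℂ) :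
    ‖ContinuousMap.toLp 2 rho ℂ
      (∑ k ∈ S, c k • monomial (primeExponents k.succPNat))‖ ^ 2 = ∑ k ∈ S, ‖c k‖ ^ 2 := by
  have h := (orthonormal_monomialH2.comp _
    primeExponents_succPNat_bijective.1).orthogonalFamily.norm_sum c S
  rw [toLp_sum_monomial, ← h]
  rfl

theorem mulC_sum_monomial (S : Finset ℕ) (c : ℕ → ℂ) (F : hardyH2) :
    mulC (∑ k ∈ S, c k • monomial (primeExponents k.succPNat)) F =
      ((∑ k ∈ S, c k • shift (primeExponents k.succPNat) F : hardyH2) : Lp ℂ 2 rho) := by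
  simp [map_sum, coe_shift, sum_apply]

/-- If the monomial multiples of `F` form an unconditional basis, then multiplication by `F` on
analytic polynomials is bounded above and below in the `L²` norm. -/
theorem IsUnconditionalBasis.exists_norm_mulC_bounds {F : hardyH2}
    (hx : IsUnconditionalBasis fun k : ℕ => shift (primeExponents k.succPNat) F) :
    ∃ C, 0 ≤ C ∧ ∀ p ∈ analyticPoly,
      ‖mulC p F‖ ≤ C * ‖ContinuousMap.toLp 2 rho ℂ p‖ ∧
      ‖ContinuousMap.toLp 2 rho ℂ p‖ ≤ C * ‖mulC p F‖ := by
  have h0 := hx.1.inner_monomialH2_zero_ne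
  obtain ⟨φ, hφ⟩ := exists_coord_of_triangular
    (x := fun k : ℕ => shift (primeExponents k.succPNat) F)
    (fun n => innerSL ℂ (monomialH2 (primeExponents n.succPNat)))
    (fun n k h => inner_monomialH2_shift_of_lt F h)
    (fun n => by rwa [innerSL_apply_apply, inner_shift_self])
  obtain ⟨K, hK, hb⟩ := hx.exists_riesz_bounds hφ
  have hF : 0 < ‖F‖ := norm_pos_iff.2 fun h => h0 (by simp [h])
  refine ⟨max (K * ‖F‖) (K / ‖F‖), by positivity, fun p hp => ?_⟩
  obtain ⟨S, c, rfl⟩ := mem_analyticPoly_iff.1 hp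
  obtain ⟨h1, h2⟩ := hb S c
  rw [mulC_sum_monomial]
  set P := ContinuousMap.toLp 2 rho ℂ (∑ k ∈ S, c k • monomial (primeExponents k.succPNat)) with hP
  set Q := ∑ k ∈ S, c k • shift (primeExponents k.succPNat) F with hQ
  have h3 : ∑ k ∈ S, ‖c k • shift (primeExponents k.succPNat) F‖ ^ 2 = (‖P‖ * ‖F‖) ^ 2 := by
    rw [mul_pow, hP, norm_toLp_sum_sq, Finset.sum_mul]
    exact Finset.sum_congr rfl fun k _ => by rw [norm_smul, norm_shift, mul_pow]
  rw [h3] at h1 h2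
  change ‖Q‖ ≤ _ ∧ ‖P‖ ≤ _ * ‖Q‖
  constructor
  · calc ‖Q‖ ≤ K * (‖P‖ * ‖F‖) :=
          (pow_le_pow_iff_left₀ (norm_nonneg _) (by positivity) two_ne_zero).1
            (h2.trans_eq (mul_pow _ _ _).symm)
      _ = K * ‖F‖ * ‖P‖ := by ring
      _ ≤ _ := by gcongr; exact le_max_left _ _
  · have h4 : ‖P‖ * ‖F‖ ≤ K * ‖Q‖ :=
      (pow_le_pow_iff_left₀ (by positivity) (by positivity) two_ne_zero).1 h1
    calc ‖P‖ ≤ K * ‖Q‖ / ‖F‖ := (le_div_iff₀ hF).2 h4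
      _ = K / ‖F‖ * ‖Q‖ := by ring
      _ ≤ _ := by gcongr; exact le_max_right _ _

theorem mem_hardyHInf_of_norm_mulC_le {F : hardyH2} {C : ℝ} (hC : 0 ≤ C)
    (h : ∀ p ∈ analyticPoly, ‖mulC p F‖ ≤ C * ‖ContinuousMap.toLp 2 rho ℂ p‖) : F ∈ hardyHInf :=
  (eLpNormEssSup_le_of_ae_bound
    (ae_norm_le_of_norm_mulC_le hC (norm_mulC_le_of_analyticPoly h))).trans_lt ENNReal.ofReal_lt_top

theorem dense_analyticPoly :
    Dense {h : hardyH2 | ∃ p ∈ analyticPoly, (h : Lp ℂ 2 rho) = ContinuousMap.toLp 2 rho ℂ p} := by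
  refine dense_span_monomialH2.mono fun h hh => ?_
  induction hh using Submodule.span_induction with
  | mem h hh =>
    obtain ⟨α, rfl⟩ := hh
    exact ⟨_, monomial_mem α, rfl⟩
  | zero => exact ⟨0, zero_mem _, by simp⟩
  | add g h _ _ hg hh =>
    obtain ⟨p, hp, hp'⟩ := hg
    obtain ⟨q, hq, hq'⟩ := hh
    exact ⟨p + q, add_mem hp hq, by simp [hp', hq']⟩
  | smul a h _ hh =>
    obtain ⟨p, hp, hp'⟩ := hh
    exact ⟨a • p, Submodule.smul_mem _ _ hp, by simp [hp']⟩

theorem mulH2_eq_mulC {F : hardyH2} (hF : F ∈ hardyHInf) {h : hardyH2} {p : C(InfTorus, ℂ)}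
    (hp : (h : Lp ℂ 2 rho) = ContinuousMap.toLp 2 rho ℂ p) :
    (mulH2 F hF h : Lp ℂ 2 rho) = mulC p F := by
  apply Lp.ext
  filter_upwards [coeFn_mulH2 hF h, coeFn_mulC p F,
    ContinuousMap.coeFn_toLp (p := 2) (𝕜 := ℂ) rho p] with ζ h1 h2 h3
  rw [h1, h2, hp, h3, mul_comm]

/-- If the monomial multiples of `F` form an unconditional basis, then `F` is invertible in
`H^∞`: multiplication by `F` is bounded and bounded below, its range contains `1`, and
the reciprocal of `F` so obtained is again a bounded multiplier. -/
theorem IsUnconditionalBasis.isInvertibleInHInf {F : hardyH2}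
    (hx : IsUnconditionalBasis fun k : ℕ => shift (primeExponents k.succPNat) F) :
    IsInvertibleInHInf F := by
  obtain ⟨C, hC, hb⟩ := hx.exists_norm_mulC_bounds
  have hF : F ∈ hardyHInf := mem_hardyHInf_of_norm_mulC_le hC fun p hp => (hb p hp).1
  have hlow : ∀ h : hardyH2, ‖h‖ ≤ C * ‖mulH2 F hF h‖ := by
    intro h
    have hcl : IsClosed {h : hardyH2 | ‖h‖ ≤ C * ‖mulH2 F hF h‖} :=
      isClosed_le continuous_norm (continuous_const.mul (mulH2 F hF).continuous.norm)
    refine closure_minimal ?_ hcl (dense_analyticPoly h)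
    rintro g ⟨p, hp, hgp⟩
    have h1 := (hb p hp).2
    rwa [← hgp, ← mulH2_eq_mulC hF hgp] at h1
  obtain ⟨G, hG⟩ : monomialH2 0 ∈ Set.range (mulH2 F hF) := by
    have hcl : IsClosed (Set.range (mulH2 F hF)) :=
      (AddMonoidHomClass.antilipschitz_of_bound (mulH2 F hF) (K := ⟨C, hC⟩) hlow).isClosed_range
        (mulH2 F hF).uniformContinuous
    -- The partial sums of the expansion of `1` in the basis lie in the closed range.
    obtain ⟨c, hc, -⟩ := hx.1 (monomialH2 0)
    refine hcl.mem_of_tendsto hc (Eventually.of_forall fun N =>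
      ⟨∑ k ∈ Finset.range N, c k • monomialH2 (primeExponents k.succPNat), ?_⟩)
    simp [mulH2_monomialH2]
  refine ⟨hF, G, mem_hardyHInf_of_norm_mulC_le hC fun p hp => ?_, (mulH2_eq_one_iff hF).1 hG⟩
  -- The lower bound applied to `p G` bounds its norm by that of `F p G = p`.
  obtain ⟨S, c, rfl⟩ := mem_analyticPoly_iff.1 hp
  have h1 := hlow (∑ k ∈ S, c k • shift (primeExponents k.succPNat) G)
  have h2 : mulH2 F hF (∑ k ∈ S, c k • shift (primeExponents k.succPNat) G) =
      ∑ k ∈ S, c k • monomialH2 (primeExponents k.succPNat) := by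
    simp [mulH2_shift, hG, shift_monomialH2]
  rw [h2] at h1
  rw [mulC_sum_monomial, toLp_sum_monomial]
  exact h1

theorem isUnconditionalBasis_shift_iff (F : hardyH2) :
    (IsUnconditionalBasis fun k : ℕ => shift (primeExponents k.succPNat) F) ↔
      IsInvertibleInHInf F :=
  ⟨fun h => h.isInvertibleInHInf, isUnconditionalBasis_shift_of_invertible⟩

/-! ### The weighted Bohr transform as an isomorphism -/

theorem hasSum_bohrT {t : ℝ} (f : DirichletSpace t) :
    HasSum (fun n : ℕ+ => (f.coeff n * (((n : ℝ) ^ (t / 2) : ℝ) : ℂ)) •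
      monomialH2 (primeExponents n)) (bohrT t f) := by
  have h := hasSum_bohr (weightMap t f)
  rwa [weightMap, DirichletSpace.coeff_ofCoeff] at h

theorem repr_bohrT {t : ℝ} (f : DirichletSpace t) (n : ℕ+) :
    (monomialBasis _ primeExponents_bijective).repr (bohrT t f) n =
      f.coeff n * (((n : ℝ) ^ (t / 2) : ℝ) : ℂ) := by
  rw [HilbertBasis.repr_apply_apply, monomialBasis_apply]
  refine ((hasSum_bohrT f).mapL (innerSL ℂ (monomialH2 (primeExponents n)))).unique ?_
  convert hasSum_single n fun m hm => ?_ using 1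
  · rw [map_smul, innerSL_apply_apply, orthonormal_iff_ite.1 orthonormal_monomialH2, if_pos rfl,
      smul_eq_mul, mul_one]
  · rw [map_smul, innerSL_apply_apply, orthonormal_iff_ite.1 orthonormal_monomialH2,
      if_neg (primeExponents_injective.ne hm.symm), smul_zero]

theorem norm_coeff_mul_rpow_sq (n : ℕ+) (t : ℝ) (a : ℂ) :
    ‖a * (((n : ℝ) ^ (t / 2) : ℝ) : ℂ)‖ ^ 2 = ‖a‖ ^ 2 * (n : ℝ) ^ t := by
  rw [norm_mul, mul_pow, Complex.norm_real, Real.norm_eq_abs, sq_abs, ← Real.rpow_natCast (_ ^ _),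
    ← Real.rpow_mul (by positivity)]
  norm_num

theorem hasSum_norm_bohrT_sq {t : ℝ} (f : DirichletSpace t) :
    HasSum (fun n : ℕ+ => ‖f.coeff n‖ ^ 2 * (n : ℝ) ^ t) (‖bohrT t f‖ ^ 2) := by
  have h := lp.hasSum_norm (p := 2) (by norm_num)
    ((monomialBasis _ primeExponents_bijective).repr (bohrT t f))
  simpa only [repr_bohrT, LinearIsometryEquiv.norm_map, ENNReal.toReal_ofNat, Real.rpow_ofNat,
    norm_coeff_mul_rpow_sq] using h

theorem hasSum_norm_sq {t : ℝ} (f : DirichletSpace t) :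
    HasSum (fun n : ℕ+ => ‖f.coeff n‖ ^ 2 * ((n : ℝ) + 1) ^ t) (‖f‖ ^ 2) := by
  rw [DirichletSpace.norm_sq]
  exact f.weightedSummable.hasSum

theorem pnat_rpow_le (n : ℕ+) (t : ℝ) : (n : ℝ) ^ t ≤ 2 ^ |t| * ((n : ℝ) + 1) ^ t := by
  have hn1 : (1 : ℝ) ≤ n := by exact_mod_cast n.pos
  exact rpow_le_of_comparable one_le_two (by positivity) (by positivity) (by linarith)
    (by linarith)

theorem pnat_add_one_rpow_le (n : ℕ+) (t : ℝ) : ((n : ℝ) + 1) ^ t ≤ 2 ^ |t| * (n : ℝ) ^ t := by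
  have hn1 : (1 : ℝ) ≤ n := by exact_mod_cast n.pos
  exact rpow_le_of_comparable one_le_two (by positivity) (by positivity) (by linarith)
    (by linarith)

theorem norm_bohrT_sq_le {t : ℝ} (f : DirichletSpace t) :
    ‖bohrT t f‖ ^ 2 ≤ 2 ^ |t| * ‖f‖ ^ 2 := by
  refine hasSum_le (fun n => ?_) (hasSum_norm_bohrT_sq f) ((hasSum_norm_sq f).mul_left (2 ^ |t|))
  rw [mul_left_comm]
  gcongr
  exact pnat_rpow_le n t

theorem norm_sq_le_norm_bohrT_sq {t : ℝ} (f : DirichletSpace t) :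
    ‖f‖ ^ 2 ≤ 2 ^ |t| * ‖bohrT t f‖ ^ 2 := by
  refine hasSum_le (fun n => ?_) (hasSum_norm_sq f) ((hasSum_norm_bohrT_sq f).mul_left (2 ^ |t|))
  rw [mul_left_comm]
  gcongr
  exact pnat_add_one_rpow_le n t

theorem eq_bohrT_of_repr {t : ℝ} {F : hardyH2} {f : DirichletSpace t}
    (h : ∀ n : ℕ+, (monomialBasis _ primeExponents_bijective).repr F n =
      f.coeff n * (((n : ℝ) ^ (t / 2) : ℝ) : ℂ)) : F = bohrT t f := by
  apply (monomialBasis _ primeExponents_bijective).repr.injective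
  ext n
  rw [h, repr_bohrT]

theorem bohrT_surjective (t : ℝ) : Function.Surjective (bohrT t) := by
  intro F
  set b := (monomialBasis _ primeExponents_bijective).repr F with hb
  have hpos : ∀ n : ℕ+, (0 : ℝ) < (n : ℝ) ^ (t / 2) := fun n => by
    have : (0 : ℝ) < n := by exact_mod_cast n.pos
    positivity
  set a : ℕ+ → ℂ := fun n => b n / (((n : ℝ) ^ (t / 2) : ℝ) : ℂ) with ha
  have hab : ∀ n : ℕ+, b n = a n * (((n : ℝ) ^ (t / 2) : ℝ) : ℂ) := fun n =>
    (div_mul_cancel₀ _ (Complex.ofReal_ne_zero.2 (hpos n).ne')).symm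
  have hs : Summable fun n : ℕ+ => ‖b n‖ ^ 2 := by
    simpa using (lp.hasSum_norm (p := 2) (by norm_num) b).summable
  have hw : WeightedSummable t a := by
    refine Summable.of_nonneg_of_le (fun n => by positivity) (fun n => ?_)
      (hs.mul_left ((2 : ℝ) ^ |t|))
    rw [hab, norm_coeff_mul_rpow_sq, mul_left_comm]
    gcongr
    exact pnat_add_one_rpow_le n t
  refine ⟨DirichletSpace.ofCoeff a hw, (eq_bohrT_of_repr fun n => ?_).symm⟩
  rw [DirichletSpace.coeff_ofCoeff, ← hab]

/-- The weighted Bohr transform `ℬ_t` as an isomorphism from `𝒟_t` onto `H²(𝕋^∞)`. -/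
def bohrTEquiv (t : ℝ) : DirichletSpace t ≃L[ℂ] hardyH2 := by
  let L : DirichletSpace t →ₗ[ℂ] hardyH2 :=
    { toFun := bohrT t
      map_add' := fun f g => by
        refine (eq_bohrT_of_repr fun n => ?_).symm
        rw [map_add, lp.coeFn_add, Pi.add_apply, repr_bohrT, repr_bohrT, DirichletSpace.coeff_add,
          Pi.add_apply, add_mul]
      map_smul' := fun c f => by
        refine (eq_bohrT_of_repr fun n => ?_).symm
        rw [RingHom.id_apply, map_smul, lp.coeFn_smul, Pi.smul_apply, repr_bohrT,
          DirichletSpace.coeff_smul, Pi.smul_apply, smul_mul_assoc] }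
  have hlow : ∀ f, ‖f‖ ≤ √(2 ^ |t|) * ‖L f‖ := fun f => by
    rw [← Real.sqrt_sq (norm_nonneg (L f)), ← Real.sqrt_mul (by positivity)]
    exact Real.le_sqrt_of_sq_le (norm_sq_le_norm_bohrT_sq f)
  have hup : ∀ f, ‖L f‖ ≤ √(2 ^ |t|) * ‖f‖ := fun f => by
    rw [← Real.sqrt_sq (norm_nonneg f), ← Real.sqrt_mul (by positivity)]
    exact Real.le_sqrt_of_sq_le (norm_bohrT_sq_le f)
  have hinj : Function.Injective L := by
    rw [injective_iff_map_eq_zero]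
    intro f hf
    have := hlow f
    rw [hf, norm_zero, mul_zero] at this
    exact norm_le_zero_iff.1 this
  let e := LinearEquiv.ofBijective L ⟨hinj, bohrT_surjective t⟩
  exact e.toContinuousLinearEquivOfBounds (√(2 ^ |t|)) (√(2 ^ |t|)) hup fun F =>
    (hlow (e.symm F)).trans_eq (by rw [show L (e.symm F) = F from e.apply_symm_apply F])

theorem bohrTEquiv_apply {t : ℝ} (f : DirichletSpace t) : bohrTEquiv t f = bohrT t f := rfl

/-! ### Power dilations under the Bohr transform -/

theorem coeff_dilate {t : ℝ} (f : DirichletSpace t) (k : ℕ+) :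
    (dilate f k).coeff = Function.extend (fun n : ℕ+ => k * n) f.coeff 0 := by
  have hinj : Function.Injective fun n : ℕ+ => k * n := mul_right_injective k
  apply DirichletSpace.coeff_eq
  intro z
  rw [← hinj.hasSum_iff fun n hn => by
    rw [Function.extend_apply' _ _ _ fun ⟨m, hm⟩ => hn ⟨m, hm⟩]; simp]
  have h : HasSum (fun n : ℕ+ => f.coeff n * ((z ^ k : 𝔻) : ℂ) ^ (n : ℕ))
      ((dilate f k).toFun z) :=
    f.hasTaylor (z ^ k)
  convert h using 1
  funext n
  simp [hinj.extend_apply, pow_mul]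

/-- The Bohr transform turns the dilation `z ↦ z^k` into multiplication by `ζ^{α(k)}`, up to
the scalar `k^{t/2}` that comes from the multiplicative weight. -/
theorem bohrT_dilate {t : ℝ} (f : DirichletSpace t) (k : ℕ+) :
    bohrT t (dilate f k) =
      (((k : ℝ) ^ (t / 2) : ℝ) : ℂ) • shift (primeExponents k) (bohrT t f) := by
  have hinj : Function.Injective fun n : ℕ+ => k * n := mul_right_injective k
  have h1 := hasSum_bohrT (dilate f k)
  rw [coeff_dilate, ← hinj.hasSum_iff fun n hn => by
    rw [Function.extend_apply' _ _ _ fun ⟨m, hm⟩ => hn ⟨m, hm⟩]; simp] at h1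
  have h2 := ((hasSum_bohrT f).mapL (shift (primeExponents k))).const_smul
    (((k : ℝ) ^ (t / 2) : ℝ) : ℂ)
  refine h1.unique ?_
  convert h2 using 1
  funext n
  rw [Function.comp_apply, hinj.extend_apply, map_smul, shift_monomialH2, primeExponents_mul,
    smul_smul, PNat.mul_coe, Nat.cast_mul, Real.mul_rpow (by positivity) (by positivity),
    Complex.ofReal_mul, mul_left_comm]

end PowerDilation

end

theorem theorem3p1 (t : ℝ) (f : PowerDilation.DirichletSpace t) :
    PowerDilation.IsUnconditionalBasis
        (fun k : ℕ => PowerDilation.dilate f k.succPNat) ↔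
      PowerDilation.IsInvertibleInHInf (PowerDilation.bohrT t f) := by
  rw [← PowerDilation.isUnconditionalBasis_shift_iff,
    ← PowerDilation.isUnconditionalBasis_map_iff (PowerDilation.bohrTEquiv t)]
  simp only [PowerDilation.bohrTEquiv_apply, PowerDilation.bohrT_dilate]
  refine PowerDilation.isUnconditionalBasis_smul_iff fun k => Complex.ofReal_ne_zero.2 ?_
  have hk : (0 : ℝ) < (k.succPNat : ℕ) := by exact_mod_cast k.succPNat.pos
  positivity
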